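/- Let $\Gamma$ be a finitely generated discrete group with a fixed finite generating set, let $\Gamma_1\ge\Gamma_2\ge\cdots$ be a decreasing sequence of finite index normal subgroups with $\bigcap_n\Gamma_n=\{e\}$, and let $X_n=\Gamma/\Gamma_n$ carry the Cayley graph structure given by the image of the generating set. Let $X=\bigsqcup_n X_n$ be an associated box space, i.e. $X$ carries a metric of bounded geometry (for each $R>0$ the balls of radius $R$ have uniformly bounded cardinality) that restricts to the edge metric on each $X_n$ and satisfies $d(X_n,X\setminus X_n)\to\infty$. Then the following are equivalent: 1. $\Gamma$ is amenable (for every finite $K\subseteq\Gamma$ and $\epsilon>0$ there is a non-empty finite $F\subseteq\Gamma$ with $|kF\,\triangle\,F|<\epsilon|F|$ for all $k\in K$); 2. $X$ has all of the properties $A$, $ULA$, $ULA_\mu$, $MSP$, $ONL$; 3. $X$ has at least one of the properties $A$, $ULA$, $ULA_\mu$, $MSP$, $ONL$. Here, with $N_R(E)=\{y: d(y,E)\le R\}$ and $\partial_RE=N_R(E)\setminus E$: * $A$: for all $R,\epsilon>0$ there are $S>0$ and a map $x\mapsto\xi_x$ from $X$ to the probability measures on $X$ such that $\|\xi_x-\xi_y\|_{\ell^1}<\epsilon$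 whenever $d(x,y)\le R$, and each $\xi_x$ is supported in the closed ball $B(x;S)$. * $ULA$: for all $R,\epsilon>0$ there is $S>0$ such that for every non-empty finite $F\subseteq X$ there is a finite $E\subseteq X$ with $\mathrm{diam}(E)\le S$ and $|\partial_RE\cap F|<\epsilon|E\cap F|$. * $ULA_\mu$: for all $R,\epsilon>0$ there is $S>0$ such that for every probability measure $\mu$ on $X$ there is a finite $E\subseteq X$ with $\mathrm{diam}(E)\le S$ and $\mu(\partial_RE)<\epsilon\mu(E)$. * $MSP$: there is $c>0$ such that for all $R>0$ there is $S>0$ such that for every probability measure $\mu$ on $X$ there is a subset $\Omega=\bigsqcup_i\Omega_i$ of $X$ with $\mu(\Omega)\ge c$, $\mathrm{diam}(\Omega_i)\le S$ for all $i$, and $d(\Omega_i,\Omega_j)>R$ for all $i\ne j$. * $ONL$: there is $c>0$ such that for all $R>0$ there is $S>0$ such that for every probability measure $\mu$ on $X$, every non-zero separable complex Hilbert space $\mathcal H$, and every bounded operator $T=(T_{x,y})$ on $\ell^2(X,\mu,\mathcal H)$ (with norm $\|\phi\|^2=\sum_x\mu(x)\|\phi(x)\|^2$) with $T_{x,y}=0$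 whenever $d(x,y)>R$, there is a unit vector $\phi\in\ell^2(X,\mu,\mathcal H)$ with $\mathrm{diam}(\mathrm{supp}(\phi))\le S$ and $\|T\phi\|\ge c\|T\|$. -/

import Mathlib

open Filter MeasureTheory
open scoped Pointwise ENNReal symmDiff

noncomputable section

namespace BoxSpaces

/-! ### Coarse properties of a metric space

Closed `R`-neighbourhoods `N_R(E)` are `Metric.cthickening R E`, diameters are taken in `[0, ∞]`
(`Metric.ediam`), and probability measures on a discrete space are `PMF`s. -/

section Metric

variable (X : Type*) [MetricSpace X]

/-- The balls of a given radius have uniformly bounded cardinality. -/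
def BoundedGeometry : Prop :=
  ∀ R : ℝ, 0 < R → ∃ n : ℕ, ∀ x : X, (Metric.closedBall x R).encard ≤ n

variable {X} in
/-- The boundary `∂_R E = N_R(E) \ E`. -/
def boundary (R : ℝ) (E : Set X) : Set X := Metric.cthickening R E \ E

/-- Uniform local amenability (for non-empty finite sets `F`). -/
def ULA : Prop :=
  ∀ R ε : ℝ, 0 < R → 0 < ε → ∃ S : ℝ, 0 < S ∧
    ∀ F : Set X, F.Finite → F.Nonempty →
      ∃ E : Set X, E.Finite ∧ Metric.ediam E ≤ ENNReal.ofReal S ∧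
        ((boundary R E ∩ F).ncard : ℝ) < ε * ((E ∩ F).ncard : ℝ)

/-- Uniform local amenability with respect to probability measures. -/
def ULAmu : Prop :=
  ∀ R ε : ℝ, 0 < R → 0 < ε → ∃ S : ℝ, 0 < S ∧
    ∀ μ : PMF X, ∃ E : Set X, E.Finite ∧ Metric.ediam E ≤ ENNReal.ofReal S ∧
      μ.toOuterMeasure (boundary R E) < ENNReal.ofReal ε * μ.toOuterMeasure E

/-- Property A. -/
def PropertyA : Prop :=
  ∀ R ε : ℝ, 0 < R → 0 < ε → ∃ S : ℝ, 0 < S ∧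
    ∃ ξ : X → PMF X,
      (∀ x y : X, dist x y ≤ R → ∑' z : X, |(ξ x z).toReal - (ξ y z).toReal| < ε) ∧
      ∀ x : X, (ξ x).support ⊆ Metric.closedBall x S

/-- The metric sparsification property; `P` is the collection of the pieces of the
decomposition, and `⋃₀ P` is the set that is decomposed. -/
def MSP : Prop :=
  ∃ c : ℝ, 0 < c ∧ ∀ R : ℝ, 0 < R → ∃ S : ℝ, 0 < S ∧
    ∀ μ : PMF X, ∃ P : Set (Set X),
      P.PairwiseDisjoint id ∧
      ENNReal.ofReal c ≤ μ.toOuterMeasure (⋃₀ P) ∧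
      (∀ A ∈ P, Metric.ediam A ≤ ENNReal.ofReal S) ∧
      ∀ A ∈ P, ∀ B ∈ P, A ≠ B → ENNReal.ofReal R < ⨅ a ∈ A, ⨅ b ∈ B, edist a b

end Metric

section ONL

variable {X : Type*}

/-- The measure on all subsets of `X` given by a probability mass function. -/
abbrev discreteMeasure (μ : PMF X) : @Measure X ⊤ := @PMF.toMeasure X ⊤ μ

/-- The Hilbert space `l²(X, μ, H)` of functions `φ : X → H` with `∑ μ(x) ‖φ(x)‖² < ∞`,
modulo the functions of norm zero. -/
abbrev WeightedL2 (μ : PMF X) (H : Type*) [NormedAddCommGroup H] : Type _ :=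
  @Lp X H ⊤ _ 2 (discreteMeasure μ)

/-- The class in `l²(X, μ, H)` of the function with value `v` at `y` and `0` elsewhere. -/
def single {H : Type*} [NormedAddCommGroup H] (μ : PMF X) (y : X) (v : H) : WeightedL2 μ H :=
  letI : MeasurableSpace X := ⊤
  indicatorConstLp 2 (s := {y}) (μ := μ.toMeasure) trivial (measure_ne_top _ _) v

/-- The support of a class in `l²(X, μ, H)`; points of mass zero do not count, and at the
other points the value of the class does not depend on the representative. -/
def supp {H : Type*} [NormedAddCommGroup H] {μ : PMF X} (φ : WeightedL2 μ H) : Set X :=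
  {x | x ∈ μ.support ∧ φ x ≠ 0}

/-- The matrix entries `T_{x,y}`, that is `v ↦ T(single y v)(x)`, vanish whenever `d(x,y) > R`. -/
def HasPropagation [MetricSpace X] {H : Type*} [NormedAddCommGroup H] [InnerProductSpace ℂ H]
    {μ : PMF X} (R : ℝ) (T : WeightedL2 μ H →L[ℂ] WeightedL2 μ H) : Prop :=
  ∀ x ∈ μ.support, ∀ y ∈ μ.support, R < dist x y → ∀ v : H, T (single μ y v) x = 0

variable (X) in
/-- The operator norm localisation property. Every separable Hilbert space is isometrically
isomorphic to one in `Type`; the zero space, which has no unit vectors, is left out. -/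
def ONL [MetricSpace X] : Prop :=
  ∃ c : ℝ, 0 < c ∧ ∀ R : ℝ, 0 < R → ∃ S : ℝ, 0 < S ∧
    ∀ (μ : PMF X) (H : Type) [NormedAddCommGroup H] [InnerProductSpace ℂ H] [CompleteSpace H]
      [TopologicalSpace.SeparableSpace H] [Nontrivial H]
      (T : WeightedL2 μ H →L[ℂ] WeightedL2 μ H), HasPropagation R T →
      ∃ φ : WeightedL2 μ H, ‖φ‖ = 1 ∧ Metric.ediam (supp φ) ≤ ENNReal.ofReal S ∧
        c * ‖T‖ ≤ ‖T φ‖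

end ONL

/-! ### Groups and box spaces -/

/-- Amenability of a discrete group: existence of (left) Følner sets. -/
def IsAmenable (Γ : Type*) [Group Γ] : Prop :=
  ∀ (K : Set Γ) (ε : ℝ), K.Finite → 0 < ε →
    ∃ F : Set Γ, F.Finite ∧ F.Nonempty ∧ ∀ k ∈ K, (((k • F) ∆ F).ncard : ℝ) < ε * (F.ncard : ℝ)

/-- The Cayley graph: distinct `x`, `y` are joined iff `y = x s` or `x = y s` with `s ∈ S`. -/
def cayleyGraph {G : Type*} [Group G] (S : Set G) : SimpleGraph G :=
  SimpleGraph.fromRel fun x y => ∃ s ∈ S, y = x * s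

/-- The given metric on `⊔ V n` turns it into a space of graphs for the finite connected graphs
`G n`: it has bounded geometry, restricts to the edge metric on every `V n`, and the distance
from `V n` to its complement tends to infinity. -/
structure IsSpaceOfGraphs {V : ℕ → Type*} [MetricSpace (Σ n, V n)]
    (G : ∀ n, SimpleGraph (V n)) : Prop where
  finite : ∀ n, Finite (V n)
  connected : ∀ n, (G n).Connected
  boundedGeometry : BoundedGeometry (Σ n, V n)
  dist_eq : ∀ (n : ℕ) (x y : V n),
    dist (⟨n, x⟩ : Σ n, V n) ⟨n, y⟩ = ((G n).dist x y : ℝ)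
  separated : ∀ R : ℝ, ∀ᶠ n in atTop,
    ∀ (x : V n) (y : Σ n, V n), y.1 ≠ n → R ≤ dist (⟨n, x⟩ : Σ n, V n) y

/-- The given metric on `⊔ Γ/Γ_n` turns it into a box space of `Γ` with respect to the subgroups
`Γ_n = N n` and the finite generating set `S`. -/
structure IsBoxSpace {Γ : Type*} [Group Γ] (S : Finset Γ) (N : ℕ → Subgroup Γ)
    [∀ n, (N n).Normal] [MetricSpace (Σ n, Γ ⧸ N n)] : Prop where
  generates : Subgroup.closure (S : Set Γ) = ⊤
  antitone : Antitone N
  finiteIndex : ∀ n, (N n).FiniteIndex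
  iInf_eq_bot : ⨅ n, N n = ⊥
  isSpaceOfGraphs : IsSpaceOfGraphs (V := fun n => Γ ⧸ N n)
    fun n => cayleyGraph ((QuotientGroup.mk : Γ → Γ ⧸ N n) '' (S : Set Γ))

end BoxSpaces

end

/-!
Pushing the uniform measures on Følner sets into the components by right translation gives
property A. For a map `ξ` as in property A and a measure `μ`, the variation of `x ↦ ξ_x(z)` along
pairs of close points, summed over `z`, is small compared with the total mass, so this holds for
some fixed `z`; by the layer cake formula some superlevel set of `x ↦ ξ_x(z)` then has small
boundary. This is `ULA_μ`, and `ULA` is the case of uniform measures.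

Under `ULA_μ`, repeatedly choosing a set of bounded diameter with small boundary and discarding its
neighbourhood exhausts at least half of the mass by well separated pieces, which is `MSP`.
Conversely, if `ULA_μ` fails for a measure then the mass of every set of diameter at most `S` grows
by a factor `1 + ε` under thickening by `R`; thickening the far apart pieces given by `MSP` many
times, without overlaps, produces more than the total mass. Applying `MSP` to the density of `Tφ`
for an almost norming `φ` shows that `T` almost attains its norm on one of the pieces, which is
`ONL`.

For the way back, let `T` be the average of the right translations by a finite set of group
elements on the `l²`-space of one component. Constants are fixed, so `‖T ^ m‖ ≥ 1`, and a localised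
`φ` with `‖T ^ m φ‖ ≥ c` has some `T ^ j φ`, `j < m`, whose norm barely drops under `T`. By
convexity it is almost invariant, and a superlevel set of `|T ^ j φ|²` is a Følner set of bounded
diameter; `ULA` provides such sets directly. They lift to the group, because the quotient maps
are eventually injective on every finite set.
-/

noncomputable section

namespace BoxSpaces

section SuperlevelSets

variable {ι X : Type*} [Countable ι] [Countable X]

theorem exists_superlevel_tsum_indicator_lt (a b : ι → X) (w : ι → ℝ≥0∞) (v : X → ℝ≥0∞) (f : X → ℝ)
    (h : ∑' i, w i * ENNReal.ofReal (f (b i) - f (a i)) < ∑' x, v x * ENNReal.ofReal (f x)) :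
    ∃ t : ℝ, 0 ≤ t ∧ ∑' i, {i | t < f (b i) ∧ ¬ t < f (a i)}.indicator w i
      < ∑' x, {x | t < f x}.indicator v x := by
  by_contra! hcon
  refine h.not_ge ?_
  have hmeas (c d : ℝ) : Measurable ((Set.Ico c d).indicator (1 : ℝ → ℝ≥0∞)) :=
    measurable_one.indicator measurableSet_Ico
  have hlayer (m : ℝ≥0∞) (c d : ℝ) :
      m * ENNReal.ofReal (d - c) = ∫⁻ t, m * (Set.Ico c d).indicator 1 t := by
    rw [lintegral_const_mul _ (hmeas c d), lintegral_indicator_one measurableSet_Ico,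
      Real.volume_Ico]
  calc ∑' x, v x * ENNReal.ofReal (f x)
      = ∫⁻ t, ∑' x, v x * (Set.Ico 0 (f x)).indicator 1 t := by
        rw [lintegral_tsum fun x => ((hmeas _ _).const_mul _).aemeasurable]
        simp only [← hlayer, sub_zero]
    _ ≤ ∫⁻ t, ∑' i, w i * (Set.Ico (f (a i)) (f (b i))).indicator 1 t := by
        refine lintegral_mono fun t => ?_
        rcases lt_or_ge t 0 with ht | ht
        · simp [ht.not_ge]
        · simpa [Set.indicator_apply, ht, and_comm] using hcon t ht
    _ = ∑' i, w i * ENNReal.ofReal (f (b i) - f (a i)) := by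
        rw [lintegral_tsum fun i => ((hmeas _ _).const_mul _).aemeasurable]
        simp only [← hlayer]

end SuperlevelSets

section ProbabilityMassFunctions

variable {X : Type*} (μ : PMF X)

theorem toOuterMeasure_ne_top (A : Set X) : μ.toOuterMeasure A ≠ ∞ := by
  rw [PMF.toOuterMeasure_apply]
  exact μ.tsum_coe_indicator_ne_top A

theorem toOuterMeasure_le_one (A : Set X) : μ.toOuterMeasure A ≤ 1 := by
  rw [PMF.toOuterMeasure_apply, ← μ.tsum_coe]
  exact ENNReal.tsum_le_tsum fun x => Set.indicator_le_self _ _ _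

theorem toOuterMeasure_iUnion {ι : Type*} {A : ι → Set X}
    (h : Pairwise (Function.onFun Disjoint A)) :
    μ.toOuterMeasure (⋃ i, A i) = ∑' i, μ.toOuterMeasure (A i) := by
  simp only [PMF.toOuterMeasure_apply, ← tsum_subtype]
  exact ENNReal.tsum_biUnion fun i _ j _ hij => h hij

theorem toOuterMeasure_union {A B : Set X} (h : Disjoint A B) :
    μ.toOuterMeasure (A ∪ B) = μ.toOuterMeasure A + μ.toOuterMeasure B := by
  simp only [PMF.toOuterMeasure_apply, ← ENNReal.tsum_add, Set.indicator_union_of_disjoint h]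

theorem exists_finset_lt_toOuterMeasure {c : ℝ≥0∞} (hc : c < 1) :
    ∃ Z : Finset X, c < μ.toOuterMeasure Z := by
  rw [← μ.tsum_coe, ENNReal.tsum_eq_iSup_sum, lt_iSup_iff] at hc
  simpa only [PMF.toOuterMeasure_apply_finset] using hc

theorem toOuterMeasure_filter (Z : Set X) (h : ∃ a ∈ Z, a ∈ μ.support) (A : Set X) :
    (μ.filter Z h).toOuterMeasure A = μ.toOuterMeasure (A ∩ Z) * (μ.toOuterMeasure Z)⁻¹ := by
  simp only [PMF.toOuterMeasure_apply, ← ENNReal.tsum_mul_right]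
  refine tsum_congr fun x => ?_
  by_cases hA : x ∈ A <;> by_cases hZ : x ∈ Z <;> simp [PMF.filter_apply, hA, hZ]

theorem toOuterMeasure_uniformOfFinset_lt_iff {F : Finset X} (hF : F.Nonempty) {A B : Set X}
    {ε : ℝ} (hε : 0 ≤ ε) :
    (PMF.uniformOfFinset F hF).toOuterMeasure A
        < ENNReal.ofReal ε * (PMF.uniformOfFinset F hF).toOuterMeasure B ↔
      ((A ∩ F).ncard : ℝ) < ε * (B ∩ F).ncard := by
  classical
  have hcard : (0 : ℝ) < F.card := by exact_mod_cast hF.card_pos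
  have hmass (C : Set X) : (PMF.uniformOfFinset F hF).toOuterMeasure C
      = ENNReal.ofReal ((C ∩ F).ncard / F.card) := by
    have hfilter : C ∩ F = (F.filter (· ∈ C) : Finset X) := by
      ext x
      simp [and_comm]
    rw [PMF.toOuterMeasure_uniformOfFinset_apply, ENNReal.ofReal_div_of_pos hcard,
      ENNReal.ofReal_natCast, ENNReal.ofReal_natCast, hfilter, Set.ncard_coe_finset]
  rw [hmass, hmass, ← ENNReal.ofReal_mul hε, ENNReal.ofReal_lt_ofReal_iff_of_nonneg (by positivity),
    ← mul_div_assoc, div_lt_div_iff_of_pos_right hcard]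

theorem tsum_ofReal_toReal_sub_le (p q : PMF X) :
    ∑' x, ENNReal.ofReal ((q x).toReal - (p x).toReal)
      ≤ ENNReal.ofReal (∑' x, |(p x).toReal - (q x).toReal|) := by
  have hsummable (r : PMF X) : Summable fun x => (r x).toReal :=
    ENNReal.summable_toReal r.tsum_coe_ne_top
  rw [ENNReal.ofReal_tsum_of_nonneg (fun _ => abs_nonneg _) ((hsummable p).sub (hsummable q)).abs]
  refine ENNReal.tsum_le_tsum fun x => ENNReal.ofReal_le_ofReal ?_
  rw [abs_sub_comm]
  exact le_abs_self _

theorem exists_tsum_mul_sub_lt_of_tsum_mul_tsum_sub_lt {ι : Type*} (a b : ι → X) (w : ι → ℝ≥0∞)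
    (ξ : X → PMF X) {ε : ℝ≥0∞}
    (h : ∑' i, w i * ∑' z, ENNReal.ofReal ((ξ (b i) z).toReal - (ξ (a i) z).toReal) < ε) :
    ∃ z, ∑' i, w i * ENNReal.ofReal ((ξ (b i) z).toReal - (ξ (a i) z).toReal)
      < ∑' x, ε * μ x * ENNReal.ofReal (ξ x z).toReal := by
  by_contra! hcon
  refine h.not_ge ?_
  calc ε = ∑' z, ∑' x, ε * μ x * ENNReal.ofReal (ξ x z).toReal := by
        rw [ENNReal.tsum_comm]
        simp only [ENNReal.ofReal_toReal (PMF.apply_ne_top _ _), ENNReal.tsum_mul_left,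
          PMF.tsum_coe, mul_one]
    _ ≤ ∑' z, ∑' i, w i * ENNReal.ofReal ((ξ (b i) z).toReal - (ξ (a i) z).toReal) :=
        ENNReal.tsum_le_tsum hcon
    _ = ∑' i, w i * ∑' z, ENNReal.ofReal ((ξ (b i) z).toReal - (ξ (a i) z).toReal) := by
        rw [ENNReal.tsum_comm]
        simp only [ENNReal.tsum_mul_left]

end ProbabilityMassFunctions

section UniformLocalAmenability

variable {X : Type*} [MetricSpace X]

theorem BoundedGeometry.finite_of_ediam_le (hX : BoundedGeometry X) {E : Set X} {S : ℝ}
    (hE : Metric.ediam E ≤ ENNReal.ofReal S) : E.Finite := by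
  rcases E.eq_empty_or_nonempty with rfl | ⟨x, hx⟩
  · exact Set.finite_empty
  obtain ⟨n, hn⟩ := hX (max S 1) (by positivity)
  refine (Set.finite_of_encard_le_coe (hn x)).subset fun y hy => ?_
  rw [Metric.mem_closedBall, ← edist_le_ofReal (by positivity)]
  exact (Metric.edist_le_ediam_of_mem hy hx).trans
    (hE.trans (ENNReal.ofReal_le_ofReal (le_max_left _ _)))

theorem BoundedGeometry.countable (hX : BoundedGeometry X) : Countable X := by
  rcases isEmpty_or_nonempty X with _ | ⟨⟨x⟩⟩
  · infer_instance
  rw [← Set.countable_univ_iff, ← Metric.iUnion_closedBall_nat x]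
  refine Set.countable_iUnion fun r => ?_
  obtain ⟨n, hn⟩ := hX (r + 1) (by positivity)
  exact ((Set.finite_of_encard_le_coe (hn x)).subset
    (Metric.closedBall_subset_closedBall (by linarith))).countable

/-- The measure on pairs of points obtained by choosing the first point according to `μ` and
giving every second point at distance at most `R` from it the same weight. It dominates the
`μ`-mass of the boundary `∂_R E` by the mass of the pairs that lead from outside `E` into `E`. -/
def neighborWeight (μ : PMF X) (R : ℝ) (p : X × X) : ℝ≥0∞ :=
  (Metric.closedBall p.1 R).indicator (fun _ => μ p.1) p.2

theorem tsum_neighborWeight_le (μ : PMF X) {R : ℝ} {n : ℕ}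
    (hn : ∀ x : X, (Metric.closedBall x R).encard ≤ n) : ∑' p, neighborWeight μ R p ≤ n := by
  rw [ENNReal.tsum_prod']
  calc ∑' x, ∑' y, neighborWeight μ R (x, y) ≤ ∑' x, n * μ x := by
        refine ENNReal.tsum_le_tsum fun x => ?_
        simp only [neighborWeight]
        rw [← tsum_subtype _ fun _ => μ x, ENNReal.tsum_set_const]
        gcongr
        exact_mod_cast hn x
    _ = n := by rw [ENNReal.tsum_mul_left, μ.tsum_coe, mul_one]

theorem toOuterMeasure_boundary_le_tsum_neighborWeight (μ : PMF X) {R : ℝ} (hR : 0 ≤ R)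
    {E : Set X} (hE : E.Finite) :
    μ.toOuterMeasure (boundary R E)
      ≤ ∑' p, {p : X × X | p.2 ∈ E ∧ p.1 ∉ E}.indicator (neighborWeight μ R) p := by
  rw [PMF.toOuterMeasure_apply, ENNReal.tsum_prod']
  refine ENNReal.tsum_le_tsum fun x => Set.indicator_apply_le' ?_ fun _ => zero_le
  rintro ⟨hx, hxE⟩
  rw [hE.isCompact.cthickening_eq_biUnion_closedBall hR, Set.mem_iUnion₂] at hx
  obtain ⟨y, hy, hxy⟩ := hx
  refine le_trans ?_ (ENNReal.le_tsum y)
  rw [Set.indicator_of_mem (show (x, y) ∈ {p : X × X | p.2 ∈ E ∧ p.1 ∉ E} from ⟨hy, hxE⟩),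
    neighborWeight, Set.indicator_of_mem (Metric.mem_closedBall_comm.1 hxy)]

theorem tsum_neighborWeight_mul_lt (μ : PMF X) {R ε : ℝ} {n : ℕ} (hε : 0 < ε)
    (hn : ∀ x : X, (Metric.closedBall x R).encard ≤ n) {ξ : X → PMF X}
    (hξ : ∀ x y : X, dist x y ≤ R →
      ∑' z, |(ξ x z).toReal - (ξ y z).toReal| < ε / (n + 1)) :
    ∑' p : X × X, neighborWeight μ R p *
      ∑' z, ENNReal.ofReal ((ξ p.2 z).toReal - (ξ p.1 z).toReal) < ENNReal.ofReal ε := by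
  calc ∑' p : X × X, neighborWeight μ R p *
        ∑' z, ENNReal.ofReal ((ξ p.2 z).toReal - (ξ p.1 z).toReal)
      ≤ ∑' p : X × X, neighborWeight μ R p * ENNReal.ofReal (ε / (n + 1)) := by
        refine ENNReal.tsum_le_tsum fun p => ?_
        by_cases hp : p.2 ∈ Metric.closedBall p.1 R
        · gcongr
          exact (tsum_ofReal_toReal_sub_le _ _).trans
            (ENNReal.ofReal_le_ofReal (hξ _ _ (Metric.mem_closedBall'.1 hp)).le)
        · simp [neighborWeight, hp]
    _ ≤ n * ENNReal.ofReal (ε / (n + 1)) := by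
        rw [ENNReal.tsum_mul_right]
        gcongr
        exact tsum_neighborWeight_le μ hn
    _ < ENNReal.ofReal ε := by
        rw [← ENNReal.ofReal_natCast, ← ENNReal.ofReal_mul (by positivity),
          ENNReal.ofReal_lt_ofReal_iff hε, mul_div_assoc', div_lt_iff₀ (by positivity)]
        linarith

theorem ediam_setOf_lt_toReal_le {ξ : X → PMF X} {S t : ℝ} (hS : 0 ≤ S) (ht : 0 ≤ t)
    (hξ : ∀ x, (ξ x).support ⊆ Metric.closedBall x S) (z : X) :
    Metric.ediam {x | t < (ξ x z).toReal} ≤ ENNReal.ofReal (2 * S) := by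
  have hball : ∀ x ∈ {x | t < (ξ x z).toReal}, dist z x ≤ S := fun x hx =>
    hξ x ((PMF.mem_support_iff _ _).2 fun h0 => (ht.trans_lt hx).ne' (by simp [h0]))
  refine Metric.ediam_le fun x hx y hy => ?_
  rw [edist_le_ofReal (by positivity)]
  linarith [dist_triangle_left x y z, hball x hx, hball y hy]

theorem PropertyA.ulaMu (hX : BoundedGeometry X) (hA : PropertyA X) : ULAmu X := by
  have := hX.countable
  intro R ε hR hε
  obtain ⟨n, hn⟩ := hX R hR
  obtain ⟨S, hS, ξ, hξ, hsupp⟩ := hA R (ε / (n + 1)) hR (by positivity)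
  refine ⟨2 * S, by positivity, fun μ => ?_⟩
  obtain ⟨z, hz⟩ := exists_tsum_mul_sub_lt_of_tsum_mul_tsum_sub_lt μ _ _ _ ξ
    (tsum_neighborWeight_mul_lt μ hε hn hξ)
  obtain ⟨t, ht, hlt⟩ := exists_superlevel_tsum_indicator_lt Prod.fst Prod.snd _ _ _ hz
  have hdiam := ediam_setOf_lt_toReal_le hS.le ht hsupp z
  have hfin := hX.finite_of_ediam_le hdiam
  refine ⟨{x | t < (ξ x z).toReal}, hfin, hdiam,
    (toOuterMeasure_boundary_le_tsum_neighborWeight μ hR.le hfin).trans_lt (hlt.trans_eq ?_)⟩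
  simp only [PMF.toOuterMeasure_apply, ← ENNReal.tsum_mul_left, Set.indicator_apply, mul_ite,
    mul_zero]

theorem ULAmu.ula (h : ULAmu X) : ULA X := by
  intro R ε hR hε
  obtain ⟨S, hS, hS'⟩ := h R ε hR hε
  refine ⟨S, hS, fun F hF hne => ?_⟩
  lift F to Finset X using hF
  obtain ⟨E, hE, hd, hlt⟩ := hS' (PMF.uniformOfFinset F hne)
  exact ⟨E, hE, hd, (toOuterMeasure_uniformOfFinset_lt_iff hne hε.le).1 hlt⟩

end UniformLocalAmenability

section Sparsification

variable {X : Type*} [MetricSpace X]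

/-- A family of sets of diameter at most `S` that are pairwise more than `R` apart: the
decompositions of the metric sparsification property. -/
structure IsSparse (R S : ℝ) (P : Set (Set X)) : Prop where
  ediam_le : ∀ A ∈ P, Metric.ediam A ≤ ENNReal.ofReal S
  separated : ∀ A ∈ P, ∀ B ∈ P, A ≠ B → ENNReal.ofReal R < ⨅ a ∈ A, ⨅ b ∈ B, edist a b

theorem disjoint_cthickening {A B : Set X} {r R : ℝ} (hr : 0 ≤ r) (hR : 2 * r < R)
    (h : ENNReal.ofReal R < ⨅ a ∈ A, ⨅ b ∈ B, edist a b) :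
    Disjoint (Metric.cthickening r A) (Metric.cthickening r B) := by
  refine Set.disjoint_left.2 fun x hxA hxB => h.not_ge ?_
  have hlt : ENNReal.ofReal r < ENNReal.ofReal (R / 2) :=
    (ENNReal.ofReal_lt_ofReal_iff (by linarith)).2 (by linarith)
  obtain ⟨a, ha, hxa⟩ := Metric.infEDist_lt_iff.1 (hxA.trans_lt hlt)
  obtain ⟨b, hb, hxb⟩ := Metric.infEDist_lt_iff.1 (hxB.trans_lt hlt)
  calc ⨅ a ∈ A, ⨅ b ∈ B, edist a b ≤ edist a b := (iInf₂_le a ha).trans (iInf₂_le b hb)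
    _ ≤ edist x a + edist x b := edist_triangle_left _ _ _
    _ ≤ ENNReal.ofReal (R / 2) + ENNReal.ofReal (R / 2) := add_le_add hxa.le hxb.le
    _ = ENNReal.ofReal R := by
      rw [← ENNReal.ofReal_add (by linarith) (by linarith), add_halves]

theorem lt_iInf_edist_of_disjoint_cthickening {A B : Set X} {R R' : ℝ} (hR' : 0 < R')
    (hR : R < R') (h : Disjoint (Metric.cthickening R' A) B) :
    ENNReal.ofReal R < ⨅ a ∈ A, ⨅ b ∈ B, edist a b := by
  refine ((ENNReal.ofReal_lt_ofReal_iff hR').2 hR).trans_le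
    (le_iInf₂ fun a ha => le_iInf₂ fun b hb => ?_)
  have hb' : ENNReal.ofReal R' < Metric.infEDist b A :=
    not_le.1 fun hle => Set.disjoint_right.1 h hb hle
  rw [edist_comm]
  exact hb'.le.trans (Metric.infEDist_le_edist_of_mem ha)

theorem IsSparse.pairwiseDisjoint {R S : ℝ} {P : Set (Set X)} (hP : IsSparse R S P) :
    P.PairwiseDisjoint id := by
  refine fun A hA B hB hAB => Set.disjoint_left.2 fun x hxA hxB => ?_
  have hle : ⨅ a ∈ A, ⨅ b ∈ B, edist a b ≤ edist x x := (iInf₂_le x hxA).trans (iInf₂_le x hxB)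
  rw [edist_self] at hle
  exact not_lt_zero ((hP.separated A hA B hB hAB).trans_le hle)

theorem IsSparse.insert {R R' S : ℝ} {P : Set (Set X)} (hP : IsSparse R S P) {E : Set X}
    (hR' : 0 < R') (hR : R < R') (hE : Metric.ediam E ≤ ENNReal.ofReal S)
    (hdisj : ∀ A ∈ P, Disjoint (Metric.cthickening R' E) A) : IsSparse R S (insert E P) where
  ediam_le := Set.forall_mem_insert.2 ⟨hE, hP.ediam_le⟩
  separated := by
    have hfar (A) (hA : A ∈ P) := lt_iInf_edist_of_disjoint_cthickening hR' hR (hdisj A hA)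
    rintro A (rfl | hA) B (rfl | hB) hAB
    · exact absurd rfl hAB
    · exact hfar B hB
    · rw [iInf₂_comm]
      simpa only [edist_comm] using hfar A hA
    · exact hP.separated A hA B hB hAB

theorem ediam_cthickening_le_ofReal {A : Set X} {r S : ℝ} (hr : 0 ≤ r) (hS : 0 ≤ S)
    (h : Metric.ediam A ≤ ENNReal.ofReal S) :
    Metric.ediam (Metric.cthickening r A) ≤ ENNReal.ofReal (S + 2 * r) := by
  lift r to NNReal using hr
  refine (Metric.ediam_cthickening_le r).trans ?_
  rw [ENNReal.ofReal_add hS (by positivity), ENNReal.ofReal_mul zero_le_two,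
    ENNReal.ofReal_ofNat, ENNReal.ofReal_coe_nnreal]
  gcongr

theorem ULAmu.exists_boundary_inter_lt (h : ULAmu X) {R ε : ℝ} (hR : 0 < R) (hε : 0 < ε) :
    ∃ S : ℝ, 0 < S ∧ ∀ (μ : PMF X) (Z : Set X), μ.toOuterMeasure Z ≠ 0 →
      ∃ E : Set X, Metric.ediam E ≤ ENNReal.ofReal S ∧
        μ.toOuterMeasure (boundary R E ∩ Z) < ENNReal.ofReal ε * μ.toOuterMeasure (E ∩ Z) := by
  obtain ⟨S, hS, hS'⟩ := h R ε hR hε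
  refine ⟨S, hS, fun μ Z hZ => ?_⟩
  have hmem : ∃ a ∈ Z, a ∈ μ.support := by
    by_contra! hcon
    exact hZ ((PMF.toOuterMeasure_apply_eq_zero_iff _ _).2
      (Set.disjoint_right.2 hcon))
  obtain ⟨E, -, hEd, hE⟩ := hS' (μ.filter Z hmem)
  refine ⟨E, hEd, ?_⟩
  rwa [toOuterMeasure_filter, toOuterMeasure_filter, ← mul_assoc, ENNReal.mul_lt_mul_iff_left
    (ENNReal.inv_ne_zero.2 (toOuterMeasure_ne_top μ Z)) (ENNReal.inv_ne_top.2 hZ)] at hE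

theorem toOuterMeasure_le_add_boundary_add_diff (μ : PMF X) (R : ℝ) (E Z : Set X) :
    μ.toOuterMeasure Z ≤ μ.toOuterMeasure (E ∩ Z) + (μ.toOuterMeasure (boundary R E ∩ Z)
      + μ.toOuterMeasure (Z \ Metric.cthickening R E)) := by
  have hcover : Z ⊆ (E ∩ Z) ∪ ((boundary R E ∩ Z) ∪ (Z \ Metric.cthickening R E)) := fun x hx => by
    by_cases hxE : x ∈ E <;> by_cases hxR : x ∈ Metric.cthickening R E <;> simp [boundary, *]
  exact (measure_mono hcover).trans ((measure_union_le _ _).trans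
    (add_le_add le_rfl (measure_union_le _ _)))

theorem exists_isSparse_le_two_mul (μ : PMF X) {R R' S : ℝ} (hR' : 0 < R') (hR : R < R')
    (h : ∀ Z : Set X, μ.toOuterMeasure Z ≠ 0 → ∃ E : Set X, Metric.ediam E ≤ ENNReal.ofReal S ∧
      μ.toOuterMeasure (boundary R' E ∩ Z) < μ.toOuterMeasure (E ∩ Z)) (Z : Finset X) :
    ∃ P : Set (Set X), IsSparse R S P ∧ ⋃₀ P ⊆ Z ∧
      μ.toOuterMeasure Z ≤ 2 * μ.toOuterMeasure (⋃₀ P) := by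
  classical
  induction Z using Finset.strongInduction with
  | H Z ih =>
  rcases eq_or_ne (μ.toOuterMeasure Z) 0 with hZ | hZ
  · exact ⟨∅, ⟨by simp, by simp⟩, by simp, by simp [hZ]⟩
  obtain ⟨E, hEd, hE⟩ := h Z hZ
  have hEne : (E ∩ Z).Nonempty := Set.nonempty_iff_ne_empty.2 fun h0 => by simp [h0] at hE
  have hsub : (E ∩ Z : Set X) ⊆ Metric.cthickening R' E :=
    Set.inter_subset_left.trans (Metric.self_subset_cthickening E)
  obtain ⟨x, hx⟩ := hEne
  obtain ⟨P, hP, hPZ, hPμ⟩ := ih (Z.filter (· ∉ Metric.cthickening R' E))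
    (Finset.filter_ssubset.2 ⟨x, hx.2, not_not.2 (hsub hx)⟩)
  rw [Finset.coe_filter] at hPZ
  have hfar : Disjoint (Metric.cthickening R' E) (⋃₀ P) :=
    Set.disjoint_right.2 fun y hy => (hPZ hy).2
  refine ⟨insert (E ∩ Z) P, ?_, ?_, ?_⟩
  · exact hP.insert hR' hR ((Metric.ediam_mono Set.inter_subset_left).trans hEd) fun A hA =>
      hfar.mono (Metric.cthickening_subset_of_subset _ Set.inter_subset_left)
        (Set.subset_sUnion_of_mem hA)
  · rw [Set.sUnion_insert]
    exact Set.union_subset Set.inter_subset_right fun y hy => (hPZ hy).1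
  · rw [Finset.coe_filter] at hPμ
    rw [Set.sUnion_insert, toOuterMeasure_union μ (hfar.mono_left hsub)]
    calc μ.toOuterMeasure Z
        ≤ μ.toOuterMeasure (E ∩ Z) + (μ.toOuterMeasure (boundary R' E ∩ Z)
          + μ.toOuterMeasure (Z \ Metric.cthickening R' E)) :=
          toOuterMeasure_le_add_boundary_add_diff μ R' E Z
      _ ≤ μ.toOuterMeasure (E ∩ Z)
          + (μ.toOuterMeasure (E ∩ Z) + 2 * μ.toOuterMeasure (⋃₀ P)) := by
          gcongr
          exact hPμ
      _ = 2 * (μ.toOuterMeasure (E ∩ Z) + μ.toOuterMeasure (⋃₀ P)) := by ring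

theorem ULAmu.msp (h : ULAmu X) : MSP X := by
  refine ⟨1 / 4, by norm_num, fun R hR => ?_⟩
  obtain ⟨S, hS, hS'⟩ := h.exists_boundary_inter_lt (R := R + 1) (by positivity) one_pos
  simp only [ENNReal.ofReal_one, one_mul] at hS'
  refine ⟨S, hS, fun μ => ?_⟩
  obtain ⟨Z, hZ⟩ := exists_finset_lt_toOuterMeasure μ
    (ENNReal.inv_lt_one.2 ENNReal.one_lt_two)
  obtain ⟨P, hP, -, hPμ⟩ :=
    exists_isSparse_le_two_mul μ (by positivity) (lt_add_one R) (hS' μ) Z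
  refine ⟨P, hP.pairwiseDisjoint, ?_, hP.ediam_le, hP.separated⟩
  calc ENNReal.ofReal (1 / 4) = 2⁻¹ * 2⁻¹ := by
        rw [show (1 / 4 : ℝ) = 2⁻¹ * 2⁻¹ by norm_num, ENNReal.ofReal_mul (by norm_num),
          ENNReal.ofReal_inv_of_pos two_pos, ENNReal.ofReal_ofNat]
    _ ≤ 2⁻¹ * (2 * μ.toOuterMeasure (⋃₀ P)) := by
        gcongr
        exact hZ.le.trans hPμ
    _ = μ.toOuterMeasure (⋃₀ P) := by
        rw [← mul_assoc, ENNReal.inv_mul_cancel two_ne_zero ENNReal.ofNat_ne_top, one_mul]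

theorem one_add_mul_toOuterMeasure_le_cthickening (μ : PMF X) {R : ℝ} {ε : ℝ≥0∞} {E : Set X}
    (h : ε * μ.toOuterMeasure E ≤ μ.toOuterMeasure (boundary R E)) :
    (1 + ε) * μ.toOuterMeasure E ≤ μ.toOuterMeasure (Metric.cthickening R E) := by
  rw [← Set.union_sdiff_cancel (Metric.self_subset_cthickening E (δ := R)),
    toOuterMeasure_union μ Set.disjoint_sdiff_right, add_mul, one_mul]
  exact add_le_add le_rfl h

theorem pow_mul_toOuterMeasure_le_cthickening (μ : PMF X) {R S D : ℝ} {ε : ℝ≥0∞} (hR : 0 ≤ R)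
    (hS : 0 ≤ S) (h : ∀ E : Set X, Metric.ediam E ≤ ENNReal.ofReal D →
      ε * μ.toOuterMeasure E ≤ μ.toOuterMeasure (boundary R E)) {A : Set X}
    (hA : Metric.ediam A ≤ ENNReal.ofReal S) {m : ℕ} (hm : S + 2 * (m * R) ≤ D) :
    (1 + ε) ^ m * μ.toOuterMeasure A ≤ μ.toOuterMeasure (Metric.cthickening (m * R) A) := by
  induction m with
  | zero => simpa using measure_mono (μ := μ.toOuterMeasure) (subset_closure (s := A))
  | succ m ih =>
    push_cast at hm ⊢
    have hD : S + 2 * (m * R) ≤ D := by linarith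
    have hdiam := (ediam_cthickening_le_ofReal (by positivity) hS hA).trans
      (ENNReal.ofReal_le_ofReal hD)
    calc (1 + ε) ^ (m + 1) * μ.toOuterMeasure A
        = (1 + ε) * ((1 + ε) ^ m * μ.toOuterMeasure A) := by ring
      _ ≤ (1 + ε) * μ.toOuterMeasure (Metric.cthickening (m * R) A) := by
          gcongr
          exact ih hD
      _ ≤ μ.toOuterMeasure (Metric.cthickening R (Metric.cthickening (m * R) A)) :=
          one_add_mul_toOuterMeasure_le_cthickening μ (h _ hdiam)
      _ ≤ μ.toOuterMeasure (Metric.cthickening ((m + 1) * R) A) := by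
          rw [add_one_mul, add_comm]
          exact measure_mono (Metric.cthickening_cthickening_subset hR (by positivity) A)

theorem IsSparse.mul_toOuterMeasure_sUnion_le_one {R S r : ℝ} {P : Set (Set X)}
    (hP : IsSparse R S P) (hr : 0 ≤ r) (hR : 2 * r < R) (μ : PMF X) {a : ℝ≥0∞}
    (h : ∀ A ∈ P, a * μ.toOuterMeasure A ≤ μ.toOuterMeasure (Metric.cthickening r A)) :
    a * μ.toOuterMeasure (⋃₀ P) ≤ 1 := by
  have hdisj : Pairwise (Function.onFun Disjoint fun A : P => Metric.cthickening r (A : Set X)) :=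
    fun A B hAB => disjoint_cthickening hr hR (hP.separated A A.2 B B.2 (Subtype.coe_ne_coe.2 hAB))
  rw [Set.sUnion_eq_iUnion, toOuterMeasure_iUnion (A := fun A : P => (A : Set X)) μ
    hP.pairwiseDisjoint.subtype, ← ENNReal.tsum_mul_left]
  calc ∑' A : P, a * μ.toOuterMeasure A
      ≤ ∑' A : P, μ.toOuterMeasure (Metric.cthickening r (A : Set X)) :=
        ENNReal.tsum_le_tsum fun A => h A A.2
    _ = μ.toOuterMeasure (⋃ A : P, Metric.cthickening r (A : Set X)) :=
        (toOuterMeasure_iUnion μ hdisj).symm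
    _ ≤ 1 := toOuterMeasure_le_one μ _

theorem MSP.ulaMu (hX : BoundedGeometry X) (h : MSP X) : ULAmu X := by
  obtain ⟨c, hc, h⟩ := h
  intro R ε hR hε
  obtain ⟨m, hm⟩ := pow_unbounded_of_one_lt (1 / c) (show 1 < 1 + ε by linarith)
  obtain ⟨S, hS, h⟩ := h (2 * (m * R) + 1) (by positivity)
  refine ⟨S + 2 * (m * R), by positivity, fun μ => ?_⟩
  obtain ⟨P, -, hPμ, hPd, hPs⟩ := h μ
  have hP : IsSparse (2 * (m * R) + 1) S P := ⟨hPd, hPs⟩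
  by_contra! hcon
  have hgrow (A) (hA : A ∈ P) := pow_mul_toOuterMeasure_le_cthickening μ hR.le hS.le
    (fun E hE => hcon E (hX.finite_of_ediam_le hE) hE) (hP.ediam_le A hA) le_rfl
  have hle : ENNReal.ofReal ((1 + ε) ^ m * c) ≤ 1 := by
    rw [ENNReal.ofReal_mul (by positivity), ENNReal.ofReal_pow (by positivity),
      ENNReal.ofReal_add zero_le_one hε.le, ENNReal.ofReal_one]
    exact (mul_le_mul_right hPμ _).trans
      (hP.mul_toOuterMeasure_sUnion_le_one (by positivity) (by linarith) μ hgrow)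
  rw [ENNReal.ofReal_le_one, ← le_div_iff₀ hc] at hle
  exact hm.not_ge hle

end Sparsification

section WeightedL2

variable {X : Type*} {μ : PMF X}

theorem forall_of_ae_discreteMeasure {p : X → Prop} (h : ∀ᵐ x ∂(discreteMeasure μ), p x) :
    ∀ x ∈ μ.support, p x := by
  let _ : MeasurableSpace X := ⊤
  rw [ae_iff, PMF.toMeasure_apply_eq_zero_iff μ trivial] at h
  exact fun x hx => not_not.1 (Set.disjoint_left.1 h hx)

theorem ae_discreteMeasure_of_forall {p : X → Prop} (h : ∀ x ∈ μ.support, p x) :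
    ∀ᵐ x ∂(discreteMeasure μ), p x := by
  let _ : MeasurableSpace X := ⊤
  rw [ae_iff, PMF.toMeasure_apply_eq_zero_iff μ trivial]
  exact Set.disjoint_left.2 fun x hx => not_not.2 (h x hx)

theorem lintegral_discreteMeasure (f : X → ℝ≥0∞) :
    ∫⁻ x, f x ∂(discreteMeasure μ) = ∑' x, μ x * f x := by
  let _ : MeasurableSpace X := ⊤
  rw [discreteMeasure, ← PMF.restrict_toMeasure_support, lintegral_countable f μ.support_countable]
  have hsingleton (x : X) : μ.toMeasure {x} = μ x := PMF.toMeasure_apply_singleton μ x trivial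
  simp only [hsingleton, mul_comm (f _)]
  exact tsum_subtype_eq_of_support_subset (f := fun x => μ x * f x)
    ((Function.support_mul_subset_left _ _).trans subset_rfl)

variable {H : Type*} [NormedAddCommGroup H]

theorem WeightedL2.ext {φ ψ : WeightedL2 μ H} (h : ∀ x ∈ μ.support, φ x = ψ x) : φ = ψ :=
  letI : MeasurableSpace X := ⊤
  Lp.ext (ae_discreteMeasure_of_forall h)

theorem single_apply (y : X) (v : H) {x : X} (hx : x ∈ μ.support) :
    single μ y v x = ({y} : Set X).indicator (fun _ => v) x :=
  letI : MeasurableSpace X := ⊤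
  forall_of_ae_discreteMeasure (indicatorConstLp_coeFn (μ := discreteMeasure μ)) x hx

namespace WeightedL2

theorem zero_apply {x : X} (hx : x ∈ μ.support) : (0 : WeightedL2 μ H) x = 0 :=
  letI : MeasurableSpace X := ⊤
  forall_of_ae_discreteMeasure (Lp.coeFn_zero H 2 (discreteMeasure μ)) x hx

theorem add_apply (φ ψ : WeightedL2 μ H) {x : X} (hx : x ∈ μ.support) :
    (φ + ψ) x = φ x + ψ x :=
  letI : MeasurableSpace X := ⊤
  forall_of_ae_discreteMeasure (Lp.coeFn_add φ ψ) x hx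

theorem smul_apply [NormedSpace ℂ H] (c : ℂ) (φ : WeightedL2 μ H) {x : X} (hx : x ∈ μ.support) :
    (c • φ) x = c • φ x :=
  letI : MeasurableSpace X := ⊤
  forall_of_ae_discreteMeasure (Lp.coeFn_smul c φ) x hx

theorem enorm_sq (φ : WeightedL2 μ H) : ‖φ‖ₑ ^ 2 = ∑' x, μ x * ‖φ x‖ₑ ^ 2 := by
  let _ : MeasurableSpace X := ⊤
  rw [Lp.enorm_def, eLpNorm_eq_lintegral_rpow_enorm_toReal two_ne_zero ENNReal.ofNat_ne_top,
    ENNReal.toReal_ofNat, ← ENNReal.rpow_ofNat, ← ENNReal.rpow_mul, one_div,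
    inv_mul_cancel₀ two_ne_zero, ENNReal.rpow_one]
  simp only [lintegral_discreteMeasure, ENNReal.rpow_ofNat]

theorem mul_norm_sq_le (φ : WeightedL2 μ H) (x : X) : (μ x).toReal * ‖φ x‖ ^ 2 ≤ ‖φ‖ ^ 2 := by
  have h : μ x * ‖φ x‖ₑ ^ 2 ≤ ‖φ‖ₑ ^ 2 := by
    rw [enorm_sq]
    exact ENNReal.le_tsum (f := fun x => μ x * ‖φ x‖ₑ ^ 2) x
  simpa using ENNReal.toReal_mono (by simp) h

/-- Evaluation at a point of positive mass, as a continuous linear map; at other points the value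
of a class depends on the representative. -/
def eval [NormedSpace ℂ H] (x : X) (hx : x ∈ μ.support) : WeightedL2 μ H →L[ℂ] H :=
  LinearMap.mkContinuous
    { toFun := fun φ => φ x
      map_add' := fun φ ψ => add_apply φ ψ hx
      map_smul' := fun c φ => smul_apply c φ hx } (√(μ x).toReal)⁻¹ <| fun φ => by
    have hpos : 0 < (μ x).toReal :=
      ENNReal.toReal_pos ((PMF.mem_support_iff _ _).1 hx) (μ.apply_ne_top x)
    rw [inv_mul_eq_div, le_div_iff₀' (Real.sqrt_pos.2 hpos)]
    refine le_of_sq_le_sq ?_ (norm_nonneg φ)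
    rw [mul_pow, Real.sq_sqrt hpos.le]
    exact mul_norm_sq_le φ x

theorem eval_apply [NormedSpace ℂ H] {x : X} (hx : x ∈ μ.support) (φ : WeightedL2 μ H) :
    eval x hx φ = φ x :=
  rfl

/-- The restriction of a class to a set of points, extended by zero. -/
def restrict (A : Set X) (φ : WeightedL2 μ H) : WeightedL2 μ H :=
  letI : MeasurableSpace X := ⊤
  ((Lp.memLp φ).indicator (s := A) trivial).toLp

theorem restrict_apply (A : Set X) (φ : WeightedL2 μ H) {x : X} (hx : x ∈ μ.support) :
    restrict A φ x = A.indicator φ x :=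
  letI : MeasurableSpace X := ⊤
  forall_of_ae_discreteMeasure (MemLp.coeFn_toLp _) x hx

theorem restrict_add_restrict_compl (A : Set X) (φ : WeightedL2 μ H) :
    restrict A φ + restrict Aᶜ φ = φ := by
  refine WeightedL2.ext fun x hx => ?_
  rw [add_apply _ _ hx, restrict_apply _ _ hx, restrict_apply _ _ hx]
  exact congrFun (Set.indicator_self_add_compl A φ) x

theorem enorm_restrict_sq (A : Set X) (φ : WeightedL2 μ H) :
    ‖restrict A φ‖ₑ ^ 2 = ∑' x : A, μ x * ‖φ x‖ₑ ^ 2 := by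
  rw [enorm_sq, tsum_subtype A fun x => μ x * ‖φ x‖ₑ ^ 2]
  refine tsum_congr fun x => ?_
  by_cases hx : x ∈ μ.support
  · rw [restrict_apply _ _ hx]
    by_cases hA : x ∈ A <;> simp [hA]
  · have hμ : μ x = 0 := (PMF.apply_eq_zero_iff _ _).2 hx
    by_cases hA : x ∈ A <;> simp [hA, hμ]

theorem tsum_enorm_restrict_sq {ι : Type*} {A : ι → Set X}
    (hA : Pairwise (Function.onFun Disjoint A)) (φ : WeightedL2 μ H) :
    ∑' i, ‖restrict (A i) φ‖ₑ ^ 2 = ‖restrict (⋃ i, A i) φ‖ₑ ^ 2 := by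
  simp only [enorm_restrict_sq]
  exact (ENNReal.tsum_biUnion (f := fun x => μ x * ‖φ x‖ₑ ^ 2) fun i _ j _ hij => hA hij).symm

theorem enorm_restrict_le (A : Set X) (φ : WeightedL2 μ H) : ‖restrict A φ‖ₑ ≤ ‖φ‖ₑ := by
  rw [← ENNReal.pow_le_pow_left_iff two_ne_zero, enorm_restrict_sq, enorm_sq φ]
  exact ENNReal.tsum_comp_le_tsum_of_injective Subtype.val_injective fun x => μ x * ‖φ x‖ₑ ^ 2

theorem sum_single_apply [NormedSpace ℂ H] (s : Finset X) (φ : WeightedL2 μ H) :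
    ∑ y ∈ s, single μ y (φ y) = restrict s φ := by
  classical
  refine WeightedL2.ext fun x hx => ?_
  rw [← eval_apply hx, map_sum, restrict_apply _ _ hx]
  simp [eval_apply, single_apply _ _ hx, Set.indicator_apply]

theorem hasSum_single_apply [NormedSpace ℂ H] (φ : WeightedL2 μ H) :
    HasSum (fun y => single μ y (φ y)) φ := by
  have hedist (s : Finset X) : edist (∑ y ∈ s, single μ y (φ y)) φ
      = (∑' x : {x // x ∉ s}, μ x * ‖φ x‖ₑ ^ 2) ^ (1 / 2 : ℝ) := by
    have htail : ‖restrict (s : Set X)ᶜ φ‖ₑ ^ 2 = ∑' x : {x // x ∉ s}, μ x * ‖φ x‖ₑ ^ 2 :=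
      enorm_restrict_sq _ _
    rw [sum_single_apply, edist_comm, edist_eq_enorm_sub,
      sub_eq_of_eq_add' (restrict_add_restrict_compl (s : Set X) φ).symm, ← htail,
      ← ENNReal.rpow_ofNat, ← ENNReal.rpow_mul]
    norm_num
  have hfin : ∑' x, μ x * ‖φ x‖ₑ ^ 2 ≠ ∞ := by
    rw [← enorm_sq]
    exact ENNReal.pow_ne_top enorm_ne_top
  refine tendsto_iff_edist_tendsto_0.2 ?_
  simp only [hedist]
  have htail := (ENNReal.continuous_rpow_const (y := 1 / 2)).tendsto 0 |>.comp
    (ENNReal.tendsto_tsum_compl_atTop_zero hfin)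
  rwa [ENNReal.zero_rpow_of_pos (by norm_num)] at htail

/-- The probability measure `‖φ(x)‖² μ(x) / ‖φ‖²` of a non-zero class `φ`. -/
def massPMF (φ : WeightedL2 μ H) (hφ : φ ≠ 0) : PMF X :=
  PMF.normalize (fun x => μ x * ‖φ x‖ₑ ^ 2) (by simpa [← enorm_sq] using hφ)
    (by simp [← enorm_sq])

theorem toOuterMeasure_massPMF (φ : WeightedL2 μ H) (hφ : φ ≠ 0) (A : Set X) :
    (massPMF φ hφ).toOuterMeasure A = ‖restrict A φ‖ₑ ^ 2 / ‖φ‖ₑ ^ 2 := by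
  rw [PMF.toOuterMeasure_apply, ← tsum_subtype, enorm_restrict_sq, div_eq_mul_inv,
    ← ENNReal.tsum_mul_right]
  simp only [massPMF, PMF.normalize_apply, enorm_sq φ]

end WeightedL2

theorem supp_restrict_subset (A : Set X) (φ : WeightedL2 μ H) : supp (φ.restrict A) ⊆ A := by
  rintro x ⟨hx, h⟩
  rw [WeightedL2.restrict_apply _ _ hx] at h
  exact Set.mem_of_indicator_ne_zero h

theorem supp_single_subset (y : X) (v : H) : supp (single μ y v) ⊆ {y} := by
  rintro x ⟨hx, h⟩
  rw [single_apply _ _ hx] at h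
  exact Set.mem_of_indicator_ne_zero h

theorem supp_smul_subset [NormedSpace ℂ H] (c : ℂ) (φ : WeightedL2 μ H) :
    supp (c • φ) ⊆ supp φ := by
  rintro x ⟨hx, h⟩
  rw [WeightedL2.smul_apply _ _ hx] at h
  exact ⟨hx, right_ne_zero_of_smul h⟩

theorem single_apply_eq_zero {φ : WeightedL2 μ H} {y : X} (hy : y ∉ supp φ) :
    single μ y (φ y) = 0 := by
  refine WeightedL2.ext fun x hx => ?_
  rw [single_apply _ _ hx, WeightedL2.zero_apply hx]
  refine Set.indicator_apply_eq_zero.2 ?_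
  rintro rfl
  exact not_not.1 fun h => hy ⟨hx, h⟩

theorem single_ne_zero {y : X} (hy : y ∈ μ.support) {v : H} (hv : v ≠ 0) : single μ y v ≠ 0 := by
  intro h
  have happly := single_apply y v hy
  rw [h, WeightedL2.zero_apply hy, Set.indicator_of_mem (Set.mem_singleton y)] at happly
  exact hv happly.symm

end WeightedL2

section OperatorNormLocalisation

variable {X : Type*} {μ : PMF X} {H : Type*} [NormedAddCommGroup H] [InnerProductSpace ℂ H]

theorem exists_norm_eq_one_of_mul_norm_le {T : WeightedL2 μ H →L[ℂ] WeightedL2 μ H}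
    {ψ : WeightedL2 μ H} (hψ : ψ ≠ 0) {a : ℝ} (h : a * ‖ψ‖ ≤ ‖T ψ‖) :
    ∃ φ : WeightedL2 μ H, ‖φ‖ = 1 ∧ supp φ ⊆ supp ψ ∧ a ≤ ‖T φ‖ := by
  refine ⟨((‖ψ‖⁻¹ : ℝ) : ℂ) • ψ, ?_, supp_smul_subset _ _, ?_⟩
  · rw [norm_smul]
    simp [hψ]
  · rwa [map_smul, norm_smul, Complex.norm_real, norm_inv, norm_norm, inv_mul_eq_div,
      le_div_iff₀ (norm_pos_iff.2 hψ)]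

variable [MetricSpace X] {R : ℝ} {T : WeightedL2 μ H →L[ℂ] WeightedL2 μ H}

theorem HasPropagation.apply_eq_zero (hT : HasPropagation R T) {φ : WeightedL2 μ H} {x : X}
    (hx : x ∈ μ.support) (hφ : ∀ y ∈ supp φ, R < dist x y) : T φ x = 0 := by
  have hterm (y : X) : WeightedL2.eval x hx (T (single μ y (φ y))) = 0 := by
    by_cases hy : y ∈ supp φ
    · exact hT x hx y hy.1 (hφ y hy) _
    · rw [single_apply_eq_zero hy, map_zero, map_zero]
  have hsum := ((WeightedL2.hasSum_single_apply φ).mapL T).mapL (WeightedL2.eval x hx)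
  simp only [hterm] at hsum
  exact hsum.unique hasSum_zero

theorem HasPropagation.apply_restrict_cthickening (hT : HasPropagation R T) {A : Set X}
    (φ : WeightedL2 μ H) {x : X} (hx : x ∈ μ.support) (hxA : x ∈ A) :
    T (φ.restrict (Metric.cthickening R A)) x = T φ x := by
  have hfar : T (φ.restrict (Metric.cthickening R A)ᶜ) x = 0 :=
    hT.apply_eq_zero hx fun y hy => not_le.1 fun hle => supp_restrict_subset _ _ hy
      (Metric.mem_cthickening_of_dist_le y x R A hxA (by rwa [dist_comm]))
  conv_rhs => rw [← φ.restrict_add_restrict_compl (Metric.cthickening R A), map_add,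
    WeightedL2.add_apply _ _ hx, hfar, add_zero]

theorem HasPropagation.enorm_restrict_apply_sq_le (hT : HasPropagation R T) (A : Set X)
    (φ : WeightedL2 μ H) :
    ‖(T φ).restrict A‖ₑ ^ 2 ≤ ‖T (φ.restrict (Metric.cthickening R A))‖ₑ ^ 2 := by
  have hrestrict : (T φ).restrict A = (T (φ.restrict (Metric.cthickening R A))).restrict A := by
    refine WeightedL2.ext fun x hx => ?_
    rw [WeightedL2.restrict_apply _ _ hx, WeightedL2.restrict_apply _ _ hx]
    by_cases hxA : x ∈ A
    · simp only [Set.indicator_of_mem hxA, hT.apply_restrict_cthickening φ hx hxA]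
    · simp only [Set.indicator_of_notMem hxA]
  rw [hrestrict]
  gcongr
  exact WeightedL2.enorm_restrict_le _ _

theorem HasPropagation.exists_mul_enorm_restrict_lt (hT : HasPropagation R T) (hR : 0 ≤ R)
    {R' S : ℝ} (hR' : 2 * R < R') {P : Set (Set X)} (hP : IsSparse R' S P) {φ : WeightedL2 μ H}
    {a : ℝ≥0∞} (h : a ^ 2 * ‖φ‖ₑ ^ 2 < ‖(T φ).restrict (⋃₀ P)‖ₑ ^ 2) :
    ∃ A ∈ P, a * ‖φ.restrict (Metric.cthickening R A)‖ₑ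
      < ‖T (φ.restrict (Metric.cthickening R A))‖ₑ := by
  have hdisj : Pairwise (Function.onFun Disjoint fun A : P => Metric.cthickening R (A : Set X)) :=
    fun A B hAB => disjoint_cthickening hR hR' (hP.separated A A.2 B B.2 (Subtype.coe_ne_coe.2 hAB))
  have hpieces := WeightedL2.tsum_enorm_restrict_sq (A := fun A : P => (A : Set X))
    hP.pairwiseDisjoint.subtype (T φ)
  by_contra! hcon
  refine h.not_ge ?_
  rw [Set.sUnion_eq_iUnion, ← hpieces]
  calc ∑' A : P, ‖(T φ).restrict (A : Set X)‖ₑ ^ 2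
      ≤ ∑' A : P, a ^ 2 * ‖φ.restrict (Metric.cthickening R (A : Set X))‖ₑ ^ 2 := by
        refine ENNReal.tsum_le_tsum fun A => (hT.enorm_restrict_apply_sq_le A φ).trans ?_
        rw [← mul_pow]
        gcongr
        exact hcon A A.2
    _ = a ^ 2 * ‖φ.restrict (⋃ A : P, Metric.cthickening R (A : Set X))‖ₑ ^ 2 := by
        rw [ENNReal.tsum_mul_left, WeightedL2.tsum_enorm_restrict_sq hdisj]
    _ ≤ a ^ 2 * ‖φ‖ₑ ^ 2 := by
        gcongr
        exact WeightedL2.enorm_restrict_le _ _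

theorem HasPropagation.exists_mul_norm_lt (hT : HasPropagation R T) (hR : 0 ≤ R) {R' S c : ℝ}
    (hR' : 2 * R < R') (hS : 0 ≤ S) (hc : 0 < c) (hT0 : T ≠ 0)
    (h : ∀ ν : PMF X, ∃ P : Set (Set X), IsSparse R' S P ∧
      ENNReal.ofReal c ≤ ν.toOuterMeasure (⋃₀ P)) :
    ∃ ψ : WeightedL2 μ H, ψ ≠ 0 ∧ Metric.ediam (supp ψ) ≤ ENNReal.ofReal (S + 2 * R) ∧
      √c / 2 * ‖T‖ * ‖ψ‖ ≤ ‖T ψ‖ := by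
  have hTpos : 0 < ‖T‖ := (norm_pos_iff (a := T)).2 hT0
  obtain ⟨φ, hφ⟩ := T.exists_mul_lt_of_lt_opNorm (r := ‖T‖ / 2) (by positivity) (by linarith)
  have hTφ : T φ ≠ 0 := norm_pos_iff.1 (lt_of_le_of_lt (by positivity) hφ)
  obtain ⟨P, hP, hPc⟩ := h ((T φ).massPMF hTφ)
  rw [WeightedL2.toOuterMeasure_massPMF] at hPc
  have hlt : ENNReal.ofReal (√c / 2 * ‖T‖) ^ 2 * ‖φ‖ₑ ^ 2 < ‖(T φ).restrict (⋃₀ P)‖ₑ ^ 2 := by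
    refine lt_of_lt_of_le ?_ (ENNReal.mul_le_of_le_div hPc)
    rw [← ofReal_norm, ← ofReal_norm, ← ENNReal.ofReal_pow (norm_nonneg _),
      ← ENNReal.ofReal_pow (norm_nonneg _), ← ENNReal.ofReal_pow (by positivity),
      ← ENNReal.ofReal_mul (by positivity), ← ENNReal.ofReal_mul hc.le,
      ENNReal.ofReal_lt_ofReal_iff (by have := norm_pos_iff.2 hTφ; positivity)]
    calc (√c / 2 * ‖T‖) ^ 2 * ‖φ‖ ^ 2 = c * (‖T‖ / 2 * ‖φ‖) ^ 2 := by
          rw [mul_pow, div_pow, Real.sq_sqrt hc.le]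
          ring
      _ < c * ‖T φ‖ ^ 2 := by gcongr
  obtain ⟨A, hA, hlt⟩ := hT.exists_mul_enorm_restrict_lt hR hR' hP hlt
  refine ⟨φ.restrict (Metric.cthickening R A), fun h0 => by simp [h0] at hlt,
    (Metric.ediam_mono (supp_restrict_subset _ _)).trans
      (ediam_cthickening_le_ofReal hR hS (hP.ediam_le A hA)), ?_⟩
  rw [← ofReal_norm, ← ofReal_norm, ← ENNReal.ofReal_mul (by positivity)] at hlt
  exact (ENNReal.ofReal_lt_ofReal_iff'.1 hlt).1.le

theorem MSP.onl (h : MSP X) : ONL X := by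
  obtain ⟨c, hc, h⟩ := h
  refine ⟨√c / 2, by positivity, fun R hR => ?_⟩
  obtain ⟨S, hS, h⟩ := h (2 * R + 1) (by positivity)
  refine ⟨S + 2 * R, by positivity, fun μ H _ _ _ _ _ T hT => ?_⟩
  suffices ∃ ψ : WeightedL2 μ H, ψ ≠ 0 ∧ Metric.ediam (supp ψ) ≤ ENNReal.ofReal (S + 2 * R) ∧
      √c / 2 * ‖T‖ * ‖ψ‖ ≤ ‖T ψ‖ by
    obtain ⟨ψ, hψ, hdiam, hle⟩ := this
    obtain ⟨φ, hφ, hsupp, hφle⟩ := exists_norm_eq_one_of_mul_norm_le hψ hle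
    exact ⟨φ, hφ, (Metric.ediam_mono hsupp).trans hdiam, hφle⟩
  rcases eq_or_ne T 0 with rfl | hT0
  · obtain ⟨x, hx⟩ := μ.support_nonempty
    obtain ⟨v, hv⟩ := exists_ne (0 : H)
    refine ⟨single μ x v, single_ne_zero hx hv, ?_, by simp⟩
    rw [Metric.ediam_subsingleton (Set.subsingleton_singleton.anti (supp_single_subset x v))]
    exact zero_le
  · refine hT.exists_mul_norm_lt hR.le (lt_add_one _) hS.le hc hT0 fun ν => ?_
    obtain ⟨P, -, hPc, hPd, hPs⟩ := h ν
    exact ⟨P, ⟨hPd, hPs⟩, hPc⟩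

end OperatorNormLocalisation

section FolnerSets

variable {G : Type*} [Group G]

/-- A non-empty finite set `E` is a right Følner set for `K` and `ε` if right multiplication by
each element of `K` moves at most the proportion `ε` of the points of `E` out of `E`. -/
structure IsRightFolner (K : Set G) (ε : ℝ) (E : Set G) : Prop where
  finite : E.Finite
  nonempty : E.Nonempty
  ncard_le : ∀ k ∈ K, ({x ∈ E | x * k ∉ E}.ncard : ℝ) ≤ ε * E.ncard

theorem ncard_smul_inv_symmDiff_le {F : Set G} (hF : F.Finite) (k : G) :
    ((k • F⁻¹) ∆ F⁻¹).ncard ≤ {g ∈ F | g * k⁻¹ ∉ F}.ncard + {g ∈ F | g * k ∉ F}.ncard := by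
  have hmem (x : G) : x ∈ k • F⁻¹ ↔ x⁻¹ * k ∈ F := by
    rw [Set.mem_smul_set_iff_inv_smul_mem, Set.mem_inv, smul_eq_mul, mul_inv_rev, inv_inv]
  refine (Set.ncard_union_le _ _).trans (add_le_add ?_ ?_)
  · refine Set.ncard_le_ncard_of_injOn (fun x => x⁻¹ * k) ?_
      (fun x _ y _ hxy => inv_injective (mul_right_cancel hxy)) (hF.subset fun g hg => hg.1)
    rintro x ⟨hx, hx'⟩
    exact ⟨(hmem x).1 hx, by simpa using hx'⟩
  · refine Set.ncard_le_ncard_of_injOn (fun x => x⁻¹) ?_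
      (fun x _ y _ hxy => inv_injective hxy) (hF.subset fun g hg => hg.1)
    rintro x ⟨hx, hx'⟩
    exact ⟨hx, fun h => hx' ((hmem x).2 h)⟩

theorem isAmenable_of_exists_isRightFolner
    (h : ∀ (K : Set G) (ε : ℝ), K.Finite → 0 < ε → ∃ F, IsRightFolner K ε F) :
    IsAmenable G := by
  intro K ε hK hε
  obtain ⟨F, hF⟩ := h (K ∪ K⁻¹) (ε / 3) (hK.union hK.inv) (by positivity)
  have hcard : (F⁻¹).ncard = F.ncard := by
    rw [← Set.image_inv_eq_inv, Set.ncard_image_of_injective _ inv_injective]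
  have hpos : (0 : ℝ) < F.ncard := Nat.cast_pos.2 ((Set.ncard_pos hF.finite).2 hF.nonempty)
  refine ⟨F⁻¹, hF.finite.inv, hF.nonempty.inv, fun k hk => ?_⟩
  calc (((k • F⁻¹) ∆ F⁻¹).ncard : ℝ)
      ≤ {g ∈ F | g * k⁻¹ ∉ F}.ncard + {g ∈ F | g * k ∉ F}.ncard :=
        mod_cast ncard_smul_inv_symmDiff_le hF.finite k
    _ ≤ ε / 3 * F.ncard + ε / 3 * F.ncard :=
        add_le_add (hF.ncard_le _ (Or.inr (Set.inv_mem_inv.2 hk))) (hF.ncard_le _ (Or.inl hk))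
    _ < ε * (F⁻¹).ncard := by rw [hcard]; nlinarith

theorem IsRightFolner.lift {Q : Type*} [Group Q] (π : G →* Q) {B K : Set G} {ε : ℝ} {E : Set Q}
    {e : Q} (hE : IsRightFolner (π '' K) ε E) (hB : B.Finite) (hBE : ∀ x ∈ E, ∃ g ∈ B, x = e * π g)
    (hinj : Set.InjOn π (B ∪ B * K)) :
    IsRightFolner K ε {g ∈ B | e * π g ∈ E} := by
  set F : Set G := {g ∈ B | e * π g ∈ E}
  have hinjF : Set.InjOn (fun g => e * π g) F := fun g hg g' hg' heq =>
    hinj (Or.inl hg.1) (Or.inl hg'.1) (mul_left_cancel heq)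
  have himage : (fun g => e * π g) '' F = E := by
    refine Set.Subset.antisymm (Set.image_subset_iff.2 fun g hg => hg.2) fun x hx => ?_
    obtain ⟨g, hg, rfl⟩ := hBE x hx
    exact ⟨g, ⟨hg, hx⟩, rfl⟩
  refine ⟨hB.subset fun g hg => hg.1, ?_, fun k hk => ?_⟩
  · rw [← Set.image_nonempty, himage]
    exact hE.nonempty
  rw [← hinjF.ncard_image, himage]
  refine le_trans (Nat.cast_le.2 ?_) (hE.ncard_le (π k) ⟨k, hk, rfl⟩)
  refine Set.ncard_le_ncard_of_injOn (fun g => e * π g) ?_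
    (hinjF.mono fun g hg => hg.1) (hE.finite.subset fun x hx => hx.1)
  rintro g ⟨hg, hgk⟩
  refine ⟨hg.2, fun hmem => hgk ?_⟩
  rw [mul_assoc, ← map_mul] at hmem
  obtain ⟨g', hg', heq⟩ := hBE _ hmem
  have hgk' : g * k = g' :=
    hinj (Or.inr (Set.mul_mem_mul hg.1 hk)) (Or.inl hg') (mul_left_cancel heq)
  rw [hgk'] at hmem ⊢
  exact ⟨hg', hmem⟩

end FolnerSets

section CayleyGraph

variable {G : Type*} [Group G] {T : Set G}

theorem cayleyGraph_adj {x y : G} :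
    (cayleyGraph T).Adj x y ↔ x ≠ y ∧ ((∃ s ∈ T, y = x * s) ∨ ∃ s ∈ T, x = y * s) :=
  SimpleGraph.fromRel_adj _ _ _

theorem exists_mem_pow_of_walk {x y : G} (p : (cayleyGraph T).Walk x y) :
    ∃ g ∈ (T ∪ T⁻¹) ^ p.length, y = x * g := by
  induction p with
  | nil => exact ⟨1, by simp, (mul_one _).symm⟩
  | cons hadj p ih =>
    obtain ⟨g, hg, rfl⟩ := ih
    rw [SimpleGraph.Walk.length_cons, pow_succ']
    obtain ⟨-, ⟨s, hs, rfl⟩ | ⟨s, hs, rfl⟩⟩ := cayleyGraph_adj.1 hadj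
    · exact ⟨s * g, Set.mul_mem_mul (Or.inl hs) hg, mul_assoc _ _ _⟩
    · exact ⟨s⁻¹ * g, Set.mul_mem_mul (Or.inr (Set.inv_mem_inv.2 hs)) hg, by group⟩

theorem cayleyGraph_dist_mul_le_one {s : G} (hs : s ∈ T) (x : G) :
    (cayleyGraph T).dist x (x * s) ≤ 1 := by
  by_cases hx : x = x * s
  · rw [← hx, SimpleGraph.dist_self]
    exact zero_le_one
  · exact (SimpleGraph.dist_eq_one_iff_adj.2 (cayleyGraph_adj.2 ⟨hx, Or.inl ⟨s, hs, rfl⟩⟩)).le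

end CayleyGraph

theorem IsSpaceOfGraphs.eventually_fst_eq {V : ℕ → Type*} [MetricSpace (Σ n, V n)]
    {G : ∀ n, SimpleGraph (V n)} (hX : IsSpaceOfGraphs G) (R : ℝ) :
    ∀ᶠ n in atTop, ∀ (x : V n) (y : Σ n, V n), dist (⟨n, x⟩ : Σ n, V n) y ≤ R → y.1 = n := by
  filter_upwards [hX.separated (R + 1)] with n hn x y hxy
  by_contra hne
  linarith [hn x y hne]

namespace IsBoxSpace

variable {Γ : Type*} [Group Γ] {S : Finset Γ} {N : ℕ → Subgroup Γ} [∀ n, (N n).Normal]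
  [MetricSpace (Σ n, Γ ⧸ N n)]

theorem exists_finite_of_dist_le (hX : IsBoxSpace S N) (R : ℝ) :
    ∃ B : Set Γ, B.Finite ∧ ∀ (n : ℕ) (x y : Γ ⧸ N n),
      dist (⟨n, x⟩ : Σ n, Γ ⧸ N n) ⟨n, y⟩ ≤ R → ∃ g ∈ B, y = x * (g : Γ ⧸ N n) := by
  have hfin (r : ℕ) : (((S : Set Γ) ∪ (S : Set Γ)⁻¹) ^ r).Finite := by
    classical exact mod_cast ((S ∪ S⁻¹) ^ r).finite_toSet
  refine ⟨⋃ r ∈ Set.Iic ⌊R⌋₊, ((S : Set Γ) ∪ (S : Set Γ)⁻¹) ^ r,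
    (Set.finite_Iic _).biUnion fun r _ => hfin r, fun n x y hxy => ?_⟩
  obtain ⟨p, hp⟩ := (hX.isSpaceOfGraphs.connected n).exists_walk_length_eq_dist x y
  rw [hX.isSpaceOfGraphs.dist_eq, ← hp] at hxy
  obtain ⟨_, hq, hy⟩ := exists_mem_pow_of_walk p
  have himage : (QuotientGroup.mk' (N n) '' ((S : Set Γ) ∪ (S : Set Γ)⁻¹)) ^ p.length
      = QuotientGroup.mk' (N n) '' ((S : Set Γ) ∪ (S : Set Γ)⁻¹) ^ p.length :=
    (Set.image_pow (QuotientGroup.mk' (N n)) _ _).symm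
  rw [Set.image_union, Set.image_inv] at himage
  obtain ⟨g, hg, rfl⟩ := himage.subset hq
  exact ⟨g, Set.mem_biUnion (Nat.le_floor hxy) hg, hy⟩

theorem exists_dist_mul_le (hX : IsBoxSpace S N) (g : Γ) :
    ∃ r : ℝ, ∀ (n : ℕ) (x : Γ ⧸ N n),
      dist (⟨n, x⟩ : Σ n, Γ ⧸ N n) ⟨n, x * (g : Γ ⧸ N n)⟩ ≤ r := by
  have hg : g ∈ Subgroup.closure (S : Set Γ) := hX.generates ▸ Subgroup.mem_top g
  induction hg using Subgroup.closure_induction with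
  | mem s hs =>
    refine ⟨1, fun n x => ?_⟩
    rw [hX.isSpaceOfGraphs.dist_eq]
    exact_mod_cast cayleyGraph_dist_mul_le_one (Set.mem_image_of_mem _ hs) x
  | one => exact ⟨0, fun n x => by simp⟩
  | mul g h _ _ hg hh =>
    obtain ⟨r, hr⟩ := hg
    obtain ⟨r', hr'⟩ := hh
    refine ⟨r + r', fun n x => (dist_triangle _ ⟨n, x * (g : Γ ⧸ N n)⟩ _).trans ?_⟩
    rw [QuotientGroup.mk_mul, ← mul_assoc]
    exact add_le_add (hr n x) (hr' n _)
  | inv g _ hg =>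
    obtain ⟨r, hr⟩ := hg
    refine ⟨r, fun n x => ?_⟩
    have hle := hr n (x * (g⁻¹ : Γ ⧸ N n))
    rwa [inv_mul_cancel_right, dist_comm] at hle

theorem exists_forall_dist_mul_le (hX : IsBoxSpace S N) {F : Set Γ} (hF : F.Finite) :
    ∃ L : ℝ, 0 < L ∧ ∀ g ∈ F, ∀ (n : ℕ) (x : Γ ⧸ N n),
      dist (⟨n, x⟩ : Σ n, Γ ⧸ N n) ⟨n, x * (g : Γ ⧸ N n)⟩ ≤ L := by
  choose r hr using hX.exists_dist_mul_le
  obtain ⟨L, hL⟩ := (hF.image r).bddAbove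
  exact ⟨max L 1, by positivity, fun g hg n x =>
    (hr g n x).trans ((hL ⟨g, hg, rfl⟩).trans (le_max_left _ _))⟩

theorem eventually_injOn (hX : IsBoxSpace S N) {B : Set Γ} (hB : B.Finite) :
    ∀ᶠ n in atTop, Set.InjOn (QuotientGroup.mk' (N n)) B := by
  have hpair (g h : Γ) : ∀ᶠ n in atTop, (g : Γ ⧸ N n) = h → g = h := by
    by_cases hgh : g⁻¹ * h ∈ ⨅ n, N n
    · rw [hX.iInf_eq_bot, Subgroup.mem_bot, inv_mul_eq_one] at hgh
      exact Eventually.of_forall fun _ _ => hgh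
    · rw [Subgroup.mem_iInf, not_forall] at hgh
      obtain ⟨m, hm⟩ := hgh
      filter_upwards [eventually_ge_atTop m] with n hn heq
      exact absurd (hX.antitone hn (QuotientGroup.eq.1 heq)) hm
  filter_upwards [hB.eventually_all.2 fun g _ => hB.eventually_all.2 fun h _ => hpair g h]
    with n hn g hg h hh using hn g hg h hh

theorem isAmenable (hX : IsBoxSpace S N)
    (h : ∀ (K : Set Γ) (ε : ℝ), K.Finite → 0 < ε → ∃ L : ℝ, ∀ᶠ n in atTop,
      ∃ E : Set (Γ ⧸ N n), IsRightFolner (QuotientGroup.mk' (N n) '' K) ε E ∧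
        ∀ x ∈ E, ∀ y ∈ E, dist (⟨n, x⟩ : Σ n, Γ ⧸ N n) ⟨n, y⟩ ≤ L) :
    IsAmenable Γ := by
  refine isAmenable_of_exists_isRightFolner fun K ε hK hε => ?_
  obtain ⟨L, hL⟩ := h K ε hK hε
  obtain ⟨B, hB, hBL⟩ := hX.exists_finite_of_dist_le L
  obtain ⟨n, ⟨E, hE, hEL⟩, hinj⟩ :=
    (hL.and (hX.eventually_injOn (hB.union (hB.mul hK)))).exists
  obtain ⟨e, he⟩ := hE.nonempty
  exact ⟨_, hE.lift _ hB (fun x hx => hBL n e x (hEL e he x hx)) hinj⟩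

end IsBoxSpace

section Reiter

open scoped Finset

variable {α β : Type*}

theorem toReal_map_uniformOfFinset [DecidableEq β] {F : Finset α} (hF : F.Nonempty) (u : α → β)
    (z : β) : ((PMF.uniformOfFinset F hF).map u z).toReal = (#{g ∈ F | u g = z} : ℝ) / #F := by
  classical
  rw [← PMF.toOuterMeasure_apply_singleton, PMF.toOuterMeasure_map_apply,
    PMF.toOuterMeasure_uniformOfFinset_apply, ENNReal.toReal_div, ENNReal.toReal_natCast,
    ENNReal.toReal_natCast]
  simp only [Set.mem_preimage, Set.mem_singleton_iff]

theorem hasSum_card_fiber [DecidableEq β] (F : Finset α) (u : α → β) :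
    HasSum (fun z => (#{g ∈ F | u g = z} : ℝ)) #F := by
  rw [Finset.card_eq_sum_card_image u F, Nat.cast_sum]
  refine hasSum_sum_of_ne_finset_zero fun z hz => ?_
  rw [Nat.cast_eq_zero, Finset.card_eq_zero, Finset.filter_eq_empty_iff]
  rintro g hg rfl
  exact hz (Finset.mem_image_of_mem u hg)

theorem abs_card_sub_card_le_card_symmDiff [DecidableEq α] (A B : Finset α) :
    |(#A : ℝ) - #B| ≤ #(A ∆ B) := by
  have hA : #A ≤ #(A ∆ B) + #B :=
    (Finset.card_le_card (by grind [Finset.mem_symmDiff])).trans (Finset.card_union_le (A ∆ B) B)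
  have hB : #B ≤ #(A ∆ B) + #A :=
    (Finset.card_le_card (by grind [Finset.mem_symmDiff])).trans (Finset.card_union_le (A ∆ B) A)
  rw [abs_sub_le_iff, sub_le_iff_le_add, sub_le_iff_le_add]
  exact ⟨mod_cast hA, mod_cast hB⟩

theorem tsum_abs_map_uniformOfFinset_sub_le [DecidableEq α] {F F' : Finset α} (hF : F.Nonempty)
    (hF' : F'.Nonempty) (hcard : #F = #F') (u : α → β) :
    ∑' z, |((PMF.uniformOfFinset F hF).map u z).toReal
        - ((PMF.uniformOfFinset F' hF').map u z).toReal| ≤ #(F ∆ F') / #F := by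
  classical
  have hle (z : β) : |((PMF.uniformOfFinset F hF).map u z).toReal
      - ((PMF.uniformOfFinset F' hF').map u z).toReal| ≤ #{g ∈ F ∆ F' | u g = z} / #F := by
    rw [toReal_map_uniformOfFinset, toReal_map_uniformOfFinset, ← hcard, ← sub_div, abs_div,
      Nat.abs_cast]
    gcongr
    refine (abs_card_sub_card_le_card_symmDiff _ _).trans (Nat.cast_le.2 (Finset.card_le_card ?_))
    grind [Finset.mem_symmDiff]
  have hsum := (hasSum_card_fiber (F ∆ F') u).div_const (#F : ℝ)
  rw [← hsum.tsum_eq]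
  exact (hsum.summable.of_nonneg_of_le (fun _ => abs_nonneg _) hle).tsum_le_tsum hle hsum.summable

theorem map_embedding_uniformOfFinset {F : Finset α} (hF : F.Nonempty) (e : α ↪ β) :
    (PMF.uniformOfFinset F hF).map e = PMF.uniformOfFinset (F.map e) (hF.map) := by
  classical
  ext z
  rw [← PMF.toOuterMeasure_apply_singleton, ← PMF.toOuterMeasure_apply_singleton,
    PMF.toOuterMeasure_map_apply, PMF.toOuterMeasure_uniformOfFinset_apply,
    PMF.toOuterMeasure_uniformOfFinset_apply, Finset.filter_map, Finset.card_map, Finset.card_map]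
  rfl

theorem map_equiv_uniformOfFinset_univ [Fintype α] [Nonempty α] (e : α ≃ α) :
    (PMF.uniformOfFinset Finset.univ Finset.univ_nonempty).map e
      = PMF.uniformOfFinset Finset.univ Finset.univ_nonempty := by
  refine (map_embedding_uniformOfFinset Finset.univ_nonempty e.toEmbedding).trans ?_
  simp only [Finset.univ_map_equiv_to_embedding]

end Reiter

theorem IsSpaceOfGraphs.propertyA {V : ℕ → Type*} [MetricSpace (Σ n, V n)]
    {G : ∀ n, SimpleGraph (V n)} (hX : IsSpaceOfGraphs G)
    (h : ∀ R ε : ℝ, 0 < R → 0 < ε → ∃ (L : ℝ) (ξ : (Σ n, V n) → PMF (Σ n, V n)),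
      (∀ (n : ℕ) (x y : V n), dist (⟨n, x⟩ : Σ n, V n) ⟨n, y⟩ ≤ R →
        ∑' z, |(ξ ⟨n, x⟩ z).toReal - (ξ ⟨n, y⟩ z).toReal| < ε) ∧
      ∀ x, (ξ x).support ⊆ Metric.closedBall x L) :
    PropertyA (Σ n, V n) := by
  intro R ε hR hε
  obtain ⟨L, ξ, hξ, hsupp⟩ := h R ε hR hε
  obtain ⟨n₀, hn₀⟩ := eventually_atTop.1 (hX.eventually_fst_eq R)
  have hfin : {x : Σ n, V n | x.1 < n₀}.Finite := by
    have := hX.finite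
    refine ((Set.finite_Iio n₀).biUnion fun n _ => Set.finite_range (Sigma.mk n)).subset ?_
    exact fun x hx => Set.mem_biUnion (x := x.1) hx ⟨x.2, rfl⟩
  have ⟨o⟩ := (hX.connected 0).nonempty
  obtain ⟨M, hM⟩ := (hfin.image fun x => dist ⟨0, o⟩ x).bddAbove
  -- On the finitely many components that need not be `R`-isolated, `ξ` is made constant.
  refine ⟨max (max L M) 1, by positivity,
    fun x => if n₀ ≤ x.1 then ξ x else PMF.pure ⟨0, o⟩, ?_, fun x => ?_⟩
  · rintro ⟨n, x⟩ ⟨m, y⟩ hxy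
    by_cases hn : n₀ ≤ n
    · obtain rfl : m = n := hn₀ n hn x ⟨m, y⟩ hxy
      simpa only [hn, if_true] using hξ m x y hxy
    · have hm : ¬ n₀ ≤ m := fun hm => by
        obtain rfl : n = m := hn₀ m hm y ⟨n, x⟩ (by rwa [dist_comm])
        exact hn hm
      simpa [hn, hm] using hε
  · by_cases hx : n₀ ≤ x.1
    · simp only [hx, if_true]
      exact (hsupp x).trans (Metric.closedBall_subset_closedBall (by simp))
    · simp only [hx, if_false, PMF.support_pure, Set.singleton_subset_iff, Metric.mem_closedBall]
      exact (hM ⟨x, not_le.1 hx, rfl⟩).trans (by simp)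

section Amenability

variable {Γ : Type*} [Group Γ] {S : Finset Γ} {N : ℕ → Subgroup Γ} [∀ n, (N n).Normal]
  [MetricSpace (Σ n, Γ ⧸ N n)]

theorem IsAmenable.propertyA (hX : IsBoxSpace S N) (hΓ : IsAmenable Γ) :
    PropertyA (Σ n, Γ ⧸ N n) := by
  classical
  refine hX.isSpaceOfGraphs.propertyA fun R ε _ hε => ?_
  obtain ⟨B, hB, hBR⟩ := hX.exists_finite_of_dist_le R
  obtain ⟨F, hF, hFne, hFB⟩ := hΓ B ε hB hε
  lift F to Finset Γ using hF
  rw [Finset.coe_nonempty] at hFne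
  obtain ⟨L, -, hLF⟩ := hX.exists_forall_dist_mul_le F.finite_toSet
  let orbit (x : Σ n, Γ ⧸ N n) (g : Γ) : Σ n, Γ ⧸ N n := ⟨x.1, x.2 * (g : Γ ⧸ N x.1)⟩
  refine ⟨L, fun x => (PMF.uniformOfFinset F hFne).map (orbit x), fun n x y hxy => ?_, ?_⟩
  · obtain ⟨k, hk, rfl⟩ := hBR n x y hxy
    have horbit : orbit ⟨n, x * (k : Γ ⧸ N n)⟩ = orbit ⟨n, x⟩ ∘ mulLeftEmbedding k := by
      funext g
      simp only [orbit, Function.comp, mulLeftEmbedding_apply, QuotientGroup.mk_mul, mul_assoc]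
    have hkF : F.map (mulLeftEmbedding k) = k • F := Finset.map_eq_image _ _
    simp only [horbit, ← PMF.map_comp, map_embedding_uniformOfFinset hFne]
    refine (tsum_abs_map_uniformOfFinset_sub_le hFne _ (Finset.card_map _).symm _).trans_lt ?_
    rw [hkF, div_lt_iff₀ (by exact_mod_cast hFne.card_pos), symmDiff_comm]
    have hlt := hFB k hk
    rwa [← Finset.coe_smul_finset, ← Finset.coe_symmDiff, Set.ncard_coe_finset,
      Set.ncard_coe_finset] at hlt
  · intro x z hz
    obtain ⟨g, hg, rfl⟩ := (PMF.mem_support_map_iff _ _ _).1 hz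
    rw [PMF.mem_support_uniformOfFinset_iff] at hg
    rw [Metric.mem_closedBall, dist_comm]
    exact hLF g hg x.1 x.2

theorem ULA.isAmenable (hX : IsBoxSpace S N) (h : ULA (Σ n, Γ ⧸ N n)) : IsAmenable Γ := by
  refine hX.isAmenable fun K ε hK hε => ?_
  obtain ⟨R, hR, hRK⟩ := hX.exists_forall_dist_mul_le hK
  obtain ⟨L, hL, h⟩ := h R ε hR hε
  refine ⟨L, Eventually.of_forall fun n => ?_⟩
  have := hX.isSpaceOfGraphs.finite n
  let ι : Γ ⧸ N n → Σ n, Γ ⧸ N n := fun x => ⟨n, x⟩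
  have hι : Function.Injective ι := sigma_mk_injective (β := fun n => Γ ⧸ N n)
  obtain ⟨A, -, hAd, hlt⟩ := h (Set.range ι) (Set.finite_range _) (Set.range_nonempty _)
  have hne : (A ∩ Set.range ι).Nonempty := by
    refine Set.nonempty_of_ncard_ne_zero fun h0 => ?_
    rw [h0, Nat.cast_zero, mul_zero] at hlt
    exact hlt.not_ge (Nat.cast_nonneg _)
  refine ⟨ι ⁻¹' A, ⟨Set.toFinite _, ?_, ?_⟩, fun x hx y hy => (edist_le_ofReal hL.le).1
    ((Metric.edist_le_ediam_of_mem (x := ι x) (y := ι y) hx hy).trans hAd)⟩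
  · obtain ⟨_, he, e, rfl⟩ := hne
    exact ⟨e, he⟩
  rintro _ ⟨k, hk, rfl⟩
  rw [← Set.ncard_image_of_injective (ι ⁻¹' A) hι, Set.image_preimage_eq_inter_range]
  refine le_trans (Nat.cast_le.2 ?_) hlt.le
  refine Set.ncard_le_ncard_of_injOn (fun x => ι (x * (k : Γ ⧸ N n))) ?_
    (fun x _ y _ hxy => mul_right_cancel (hι hxy)) ((Set.finite_range _).inter_of_right _)
  rintro x ⟨hx, hxk⟩
  refine ⟨⟨Metric.mem_cthickening_of_dist_le _ (ι x) R A hx ?_, hxk⟩, Set.mem_range_self _⟩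
  rw [dist_comm]
  exact hRK k hk n x

end Amenability

section AlmostInvariant

theorem exists_mul_norm_pow_apply_le {𝕜 E : Type*} [NontriviallyNormedField 𝕜]
    [NormedAddCommGroup E] [NormedSpace 𝕜 E] (T : E →L[𝕜] E) {φ : E} {q : ℝ} (hq : 0 ≤ q) {m : ℕ}
    (hm : q ^ m * ‖φ‖ < ‖(T ^ m) φ‖) :
    ∃ j < m, (T ^ j) φ ≠ 0 ∧ q * ‖(T ^ j) φ‖ ≤ ‖T ((T ^ j) φ)‖ := by
  by_contra! hcon
  have hgeom : ‖(T ^ m) φ‖ ≤ q ^ m * ‖(T ^ 0) φ‖ := by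
    refine le_geom (u := fun j => ‖(T ^ j) φ‖) hq m fun j hj => ?_
    rw [pow_succ']
    by_cases h0 : (T ^ j) φ = 0
    · rw [mul_apply_eq_comp, h0, map_zero, norm_zero, mul_zero]
    · exact (hcon j hj h0).le
  exact hm.not_ge hgeom

theorem sum_norm_sub_mean_sq (𝕜 : Type*) {ι E : Type*} [RCLike 𝕜] [NormedAddCommGroup E]
    [InnerProductSpace 𝕜 E] [Fintype ι] [Nonempty ι] (v : ι → E) :
    ∑ i, ‖v i - (Fintype.card ι : 𝕜)⁻¹ • ∑ j, v j‖ ^ 2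
      = ∑ i, ‖v i‖ ^ 2 - Fintype.card ι * ‖(Fintype.card ι : 𝕜)⁻¹ • ∑ j, v j‖ ^ 2 := by
  set m : E := (Fintype.card ι : 𝕜)⁻¹ • ∑ j, v j with hm
  have hsum : ∑ j, v j = (Fintype.card ι : 𝕜) • m := by
    rw [hm, smul_inv_smul₀ (Nat.cast_ne_zero.2 Fintype.card_ne_zero)]
  have hinner : RCLike.re (inner 𝕜 (∑ j, v j) m) = Fintype.card ι * ‖m‖ ^ 2 := by
    rw [hsum, inner_smul_left, inner_self_eq_norm_sq_to_K, map_natCast, ← RCLike.ofReal_natCast,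
      ← RCLike.ofReal_pow, ← RCLike.ofReal_mul, RCLike.ofReal_re]
  simp only [@norm_sub_sq 𝕜]
  rw [Finset.sum_add_distrib, Finset.sum_sub_distrib, ← Finset.mul_sum, ← map_sum, ← sum_inner,
    hinner, Finset.sum_const, Finset.card_univ, nsmul_eq_mul]
  ring

variable {ι E : Type*} [Fintype ι] [NormedAddCommGroup E] [InnerProductSpace ℂ E]

/-- The average of a finite family of isometries. -/
def average (U : ι → E →ₗᵢ[ℂ] E) : E →L[ℂ] E :=
  (Fintype.card ι : ℂ)⁻¹ • ∑ i, (U i).toContinuousLinearMap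

theorem average_apply (U : ι → E →ₗᵢ[ℂ] E) (ψ : E) :
    average U ψ = (Fintype.card ι : ℂ)⁻¹ • ∑ i, U i ψ := by
  simp [average]

variable [Nonempty ι]

theorem norm_sub_le_of_mul_norm_le_norm_average {U : ι → E →ₗᵢ[ℂ] E} {ψ : E} {q η : ℝ}
    (hq : 0 ≤ q) (hη : 0 ≤ η) (hqη : Fintype.card ι * (1 - q ^ 2) ≤ (η / 2) ^ 2)
    (h : q * ‖ψ‖ ≤ ‖average U ψ‖) (i j : ι) : ‖U i ψ - U j ψ‖ ≤ η * ‖ψ‖ := by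
  have hvar : ∑ i, ‖U i ψ - average U ψ‖ ^ 2
      = Fintype.card ι * (‖ψ‖ ^ 2 - ‖average U ψ‖ ^ 2) := by
    rw [average_apply, sum_norm_sub_mean_sq]
    simp only [LinearIsometry.norm_map, Finset.sum_const, Finset.card_univ, nsmul_eq_mul, mul_sub]
  have hmean (i : ι) : ‖U i ψ - average U ψ‖ ≤ η / 2 * ‖ψ‖ := by
    refine le_of_sq_le_sq ?_ (by positivity)
    calc ‖U i ψ - average U ψ‖ ^ 2 ≤ ∑ i, ‖U i ψ - average U ψ‖ ^ 2 :=
          Finset.single_le_sum (f := fun i => ‖U i ψ - average U ψ‖ ^ 2)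
            (fun _ _ => by positivity) (Finset.mem_univ i)
      _ ≤ Fintype.card ι * (‖ψ‖ ^ 2 - (q * ‖ψ‖) ^ 2) := by rw [hvar]; gcongr
      _ = Fintype.card ι * (1 - q ^ 2) * ‖ψ‖ ^ 2 := by ring
      _ ≤ (η / 2) ^ 2 * ‖ψ‖ ^ 2 := by gcongr
      _ = (η / 2 * ‖ψ‖) ^ 2 := by ring
  calc ‖U i ψ - U j ψ‖ ≤ ‖U i ψ - average U ψ‖ + ‖average U ψ - U j ψ‖ :=
        norm_sub_le_norm_sub_add_norm_sub _ _ _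
    _ ≤ η / 2 * ‖ψ‖ + η / 2 * ‖ψ‖ := add_le_add (hmean i) (norm_sub_rev (U j ψ) _ ▸ hmean j)
    _ = η * ‖ψ‖ := by ring

theorem one_le_norm_average_pow {U : ι → E →ₗᵢ[ℂ] E} {e : E} (he : e ≠ 0) (hU : ∀ i, U i e = e)
    (m : ℕ) : 1 ≤ ‖average U ^ m‖ := by
  have hfix : average U e = e := by
    rw [average_apply]
    simp only [hU, Finset.sum_const, Finset.card_univ, ← Nat.cast_smul_eq_nsmul ℂ]
    exact inv_smul_smul₀ (Nat.cast_ne_zero.2 Fintype.card_ne_zero) e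
  have hpow : (average U ^ m) e = e := by
    rw [pow_apply_eq_iterate]
    exact Function.iterate_fixed hfix m
  have hle := (average U ^ m).le_opNorm e
  rw [hpow] at hle
  exact (le_mul_iff_one_le_left (norm_pos_iff.2 he)).1 hle

theorem exists_average_pow_almost_invariant {U : ι → E →ₗᵢ[ℂ] E} {e φ : E} (he : e ≠ 0)
    (hU : ∀ i, U i e = e) {c q η : ℝ} {m : ℕ} (hq : 0 ≤ q) (hη : 0 ≤ η)
    (hqη : Fintype.card ι * (1 - q ^ 2) ≤ (η / 2) ^ 2) (hqm : q ^ m < c) (hφ : ‖φ‖ = 1)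
    (h : c * ‖average U ^ m‖ ≤ ‖(average U ^ m) φ‖) :
    ∃ j < m, (average U ^ j) φ ≠ 0 ∧
      ∀ k l, ‖U k ((average U ^ j) φ) - U l ((average U ^ j) φ)‖ ≤ η * ‖(average U ^ j) φ‖ := by
  have hc : c ≤ c * ‖average U ^ m‖ :=
    le_mul_of_one_le_right ((pow_nonneg hq m).trans hqm.le) (one_le_norm_average_pow he hU m)
  obtain ⟨j, hj, hne, hle⟩ := exists_mul_norm_pow_apply_le (average U) hq (m := m) (φ := φ)
    (by rw [hφ, mul_one]; exact hqm.trans_le (hc.trans h))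
  exact ⟨j, hj, hne, norm_sub_le_of_mul_norm_le_norm_average hq hη hqη hle⟩

end AlmostInvariant

theorem exists_lt_one_mul_one_sub_sq_le {d δ : ℝ} (hd : 0 ≤ d) (hδ : 0 < δ) :
    ∃ q : ℝ, 0 ≤ q ∧ q < 1 ∧ d * (1 - q ^ 2) ≤ δ := by
  refine ⟨√(d / (d + δ)), Real.sqrt_nonneg _, ?_, ?_⟩
  · rw [Real.sqrt_lt' zero_lt_one, one_pow, div_lt_one (by positivity)]
    linarith
  · rw [Real.sq_sqrt (by positivity), one_sub_div (by positivity), add_sub_cancel_left,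
      ← mul_div_assoc, div_le_iff₀ (by positivity)]
    nlinarith

section Koopman

variable {X H : Type*} [NormedAddCommGroup H] {μ : PMF X}

theorem WeightedL2.tsum_mul_enorm_mul_enorm_le (φ ψ : WeightedL2 μ H) :
    ∑' x, μ x * (‖φ x‖ₑ * ‖ψ x‖ₑ) ≤ ‖φ‖ₑ * ‖ψ‖ₑ := by
  let _ : MeasurableSpace X := ⊤
  have henorm (χ : WeightedL2 μ H) :
      ‖χ‖ₑ = (∫⁻ x, ‖χ x‖ₑ ^ (2 : ℝ) ∂(discreteMeasure μ)) ^ (1 / 2 : ℝ) := by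
    rw [Lp.enorm_def, eLpNorm_eq_lintegral_rpow_enorm_toReal two_ne_zero ENNReal.ofNat_ne_top,
      ENNReal.toReal_ofNat]
  rw [← lintegral_discreteMeasure, henorm φ, henorm ψ]
  exact ENNReal.lintegral_mul_le_Lp_mul_Lq _ Real.HolderConjugate.two_two
    measurable_from_top.aemeasurable measurable_from_top.aemeasurable

theorem WeightedL2.sub_apply (φ ψ : WeightedL2 μ H) {x : X} (hx : x ∈ μ.support) :
    (φ - ψ) x = φ x - ψ x :=
  letI : MeasurableSpace X := ⊤
  forall_of_ae_discreteMeasure (Lp.coeFn_sub φ ψ) x hx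

theorem ofReal_norm_sq_sub_norm_sq_le {E : Type*} [SeminormedAddCommGroup E] (x y : E) :
    ENNReal.ofReal (‖x‖ ^ 2 - ‖y‖ ^ 2) ≤ ‖x - y‖ₑ * ‖x‖ₑ + ‖x - y‖ₑ * ‖y‖ₑ := by
  have hle : ‖x‖ ^ 2 - ‖y‖ ^ 2 ≤ ‖x - y‖ * (‖x‖ + ‖y‖) := by
    rw [sq_sub_sq, mul_comm]
    gcongr
    exact norm_sub_norm_le x y
  rw [← mul_add, ← ofReal_norm, ← ofReal_norm x, ← ofReal_norm y,
    ← ENNReal.ofReal_add (norm_nonneg _) (norm_nonneg _), ← ENNReal.ofReal_mul (norm_nonneg _)]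
  exact ENNReal.ofReal_le_ofReal hle

theorem WeightedL2.tsum_mul_ofReal_norm_sq_sub_norm_sq_le (φ ψ : WeightedL2 μ H) :
    ∑' x, μ x * ENNReal.ofReal (‖φ x‖ ^ 2 - ‖ψ x‖ ^ 2)
      ≤ ‖φ - ψ‖ₑ * ‖φ‖ₑ + ‖φ - ψ‖ₑ * ‖ψ‖ₑ := by
  refine le_trans ?_ (add_le_add (tsum_mul_enorm_mul_enorm_le (φ - ψ) φ)
    (tsum_mul_enorm_mul_enorm_le (φ - ψ) ψ))
  rw [← ENNReal.tsum_add]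
  refine ENNReal.tsum_le_tsum fun x => ?_
  by_cases hx : x ∈ μ.support
  · rw [← mul_add, sub_apply φ ψ hx]
    gcongr
    exact ofReal_norm_sq_sub_norm_sq_le _ _
  · rw [(μ.apply_eq_zero_iff x).2 hx, zero_mul]
    exact zero_le

theorem apply_mem_support_of_map_eq {u : X → X} (hu : μ.map u = μ) {x : X} (hx : x ∈ μ.support) :
    u x ∈ μ.support := by
  rw [← hu, PMF.mem_support_map_iff]
  exact ⟨x, hx, rfl⟩

theorem measurePreserving_discreteMeasure {u : X → X} (hu : μ.map u = μ) :
    @MeasurePreserving X X ⊤ ⊤ u (discreteMeasure μ) (discreteMeasure μ) :=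
  letI : MeasurableSpace X := ⊤
  ⟨measurable_from_top, by rw [discreteMeasure, PMF.toMeasure_map _ _ measurable_from_top, hu]⟩

variable [InnerProductSpace ℂ H]

/-- The Koopman isometry `φ ↦ φ ∘ u` of a map `u` preserving `μ`. -/
def koopman {u : X → X} (hu : μ.map u = μ) : WeightedL2 μ H →ₗᵢ[ℂ] WeightedL2 μ H :=
  letI : MeasurableSpace X := ⊤
  Lp.compMeasurePreservingₗᵢ ℂ u (measurePreserving_discreteMeasure hu)

theorem koopman_apply {u : X → X} (hu : μ.map u = μ) (φ : WeightedL2 μ H) {x : X}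
    (hx : x ∈ μ.support) : koopman hu φ x = φ (u x) :=
  letI : MeasurableSpace X := ⊤
  forall_of_ae_discreteMeasure
    (Lp.coeFn_compMeasurePreserving φ (measurePreserving_discreteMeasure hu)) x hx

theorem koopman_id (hu : μ.map id = μ) (φ : WeightedL2 μ H) : koopman hu φ = φ :=
  WeightedL2.ext fun _ hx => koopman_apply hu φ hx

theorem exists_ne_zero_forall_koopman_eq (μ : PMF X) (H : Type*) [NormedAddCommGroup H]
    [InnerProductSpace ℂ H] [Nontrivial H] :
    ∃ e : WeightedL2 μ H, e ≠ 0 ∧ ∀ (u : X → X) (hu : μ.map u = μ), koopman hu e = e := by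
  let _ : MeasurableSpace X := ⊤
  obtain ⟨v, hv⟩ := exists_ne (0 : H)
  have hconst (x : X) (hx : x ∈ μ.support) : Lp.const 2 (discreteMeasure μ) v x = v :=
    forall_of_ae_discreteMeasure (Lp.coeFn_const (p := 2) (μ := discreteMeasure μ) v) x hx
  refine ⟨Lp.const 2 (discreteMeasure μ) v, fun h0 => ?_, fun u hu => WeightedL2.ext fun x hx => ?_⟩
  · obtain ⟨x, hx⟩ := μ.support_nonempty
    have hvx := hconst x hx
    rw [h0, WeightedL2.zero_apply hx] at hvx
    exact hv hvx.symm
  · rw [koopman_apply hu _ hx, hconst x hx, hconst _ (apply_mem_support_of_map_eq hu hx)]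

variable {κ : Type*} [Fintype κ] {u : κ → X → X} (hu : ∀ k, μ.map (u k) = μ)

theorem average_koopman_apply (φ : WeightedL2 μ H) {x : X} (hx : x ∈ μ.support) :
    average (fun k => koopman (hu k)) φ x = (Fintype.card κ : ℂ)⁻¹ • ∑ k, φ (u k x) := by
  rw [average_apply, ← WeightedL2.eval_apply hx, map_smul, map_sum]
  simp only [WeightedL2.eval_apply, koopman_apply _ _ hx]

variable [MetricSpace X] {L : ℝ}

theorem supp_average_koopman_pow_subset (hL : 0 ≤ L) (huL : ∀ k x, dist x (u k x) ≤ L)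
    (φ : WeightedL2 μ H) (m : ℕ) :
    supp ((average (fun k => koopman (hu k)) ^ m) φ) ⊆ Metric.cthickening (m * L) (supp φ) := by
  induction m with
  | zero => simpa using subset_closure
  | succ m ih =>
    rw [pow_succ', mul_apply_eq_comp]
    set ψ := (average (fun k => koopman (hu k)) ^ m) φ
    have hstep : supp (average (fun k => koopman (hu k)) ψ) ⊆ Metric.cthickening L (supp ψ) := by
      rintro x ⟨hx, h⟩
      rw [average_koopman_apply hu ψ hx] at h
      obtain ⟨k, -, hk⟩ := Finset.exists_ne_zero_of_sum_ne_zero (right_ne_zero_of_smul h)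
      exact Metric.mem_cthickening_of_dist_le _ (u k x) _ _
        ⟨apply_mem_support_of_map_eq (hu k) hx, hk⟩ (huL k x)
    have hthick := (hstep.trans (Metric.cthickening_subset_of_subset L ih)).trans
      (Metric.cthickening_cthickening_subset hL (by positivity : 0 ≤ (m : ℝ) * L) (supp φ))
    rwa [show L + m * L = ((m + 1 : ℕ) : ℝ) * L by push_cast; ring] at hthick

theorem hasPropagation_average_koopman_pow (hL : 0 ≤ L) (huL : ∀ k x, dist x (u k x) ≤ L) (m : ℕ) :
    HasPropagation (m * L)
      (average (fun k => koopman (hu k)) ^ m : WeightedL2 μ H →L[ℂ] WeightedL2 μ H) := by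
  intro x hx y _ hxy v
  by_contra hne
  have hmem := Metric.cthickening_subset_of_subset _ (supp_single_subset y v)
    (supp_average_koopman_pow_subset hu hL huL (single μ y v) m ⟨hx, hne⟩)
  rw [Metric.cthickening_singleton y (by positivity)] at hmem
  exact hxy.not_ge hmem

end Koopman

section FolnerFromLocalisation

variable {X κ : Type*}

theorem ONL.exists_koopman_almost_invariant [MetricSpace X] [Finite κ] (h : ONL X) {L η : ℝ}
    (hL : 0 ≤ L) (hη : 0 < η) :
    ∃ S : ℝ, 0 < S ∧ ∀ (μ : PMF X) (u : κ → X → X) (hu : ∀ k, μ.map (u k) = μ),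
      (∀ k x, dist x (u k x) ≤ L) → ∃ ψ : WeightedL2 μ ℂ, ψ ≠ 0 ∧
        Metric.ediam (supp ψ) ≤ ENNReal.ofReal S ∧
        ∀ k, ‖koopman (hu k) ψ - ψ‖ ≤ η * ‖ψ‖ := by
  have := Fintype.ofFinite κ
  obtain ⟨c, hc, h⟩ := h
  obtain ⟨q, hq, hq1, hqη⟩ := exists_lt_one_mul_one_sub_sq_le
    (d := Fintype.card (Option κ)) (Nat.cast_nonneg _) (δ := (η / 2) ^ 2) (by positivity)
  obtain ⟨m, hm⟩ := exists_pow_lt_of_lt_one hc hq1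
  obtain ⟨D, hD, h⟩ := h (m * L + 1) (by positivity)
  refine ⟨D + 2 * (m * L), by positivity, fun μ u hu huL => ?_⟩
  -- The identity is added to the family, so that almost equal images are almost equal to `ψ`.
  let u' : Option κ → X → X := fun k => k.elim id u
  have hu' : ∀ k, μ.map (u' k) = μ := Option.forall.2 ⟨μ.map_id, hu⟩
  have huL' : ∀ k x, dist x (u' k x) ≤ L :=
    Option.forall.2 ⟨fun x => (dist_self x).trans_le hL, huL⟩
  set T : WeightedL2 μ ℂ →L[ℂ] WeightedL2 μ ℂ := average fun k => koopman (hu' k)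
  obtain ⟨φ, hφ, hφD, hφT⟩ := h μ ℂ (T ^ m) fun x hx y hy hxy =>
    hasPropagation_average_koopman_pow hu' hL huL' m x hx y hy (by linarith)
  obtain ⟨e, he, hfix⟩ := exists_ne_zero_forall_koopman_eq μ ℂ
  obtain ⟨j, hj, hne, hinv⟩ := exists_average_pow_almost_invariant he
    (fun k => hfix (u' k) (hu' k)) hq hη.le hqη hm hφ hφT
  refine ⟨(T ^ j) φ, hne, ?_, fun k => ?_⟩
  · have hjm : (j : ℝ) * L ≤ m * L := by gcongr
    refine (Metric.ediam_mono ((supp_average_koopman_pow_subset hu' hL huL' φ j).trans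
      (Metric.cthickening_mono hjm _))).trans ?_
    exact ediam_cthickening_le_ofReal (by positivity) hD.le hφD
  · have hid : koopman (hu' none) ((T ^ j) φ) = (T ^ j) φ := koopman_id (hu' none) _
    have hk := hinv (some k) none
    rw [hid] at hk
    exact hk

variable {H : Type*} [NormedAddCommGroup H] [InnerProductSpace ℂ H] {μ : PMF X}

theorem tsum_mul_ofReal_norm_sq_sub_norm_sq_comp_le {u : X → X} (hu : μ.map u = μ)
    {ψ : WeightedL2 μ H} {η : ℝ} (hη : 0 ≤ η) (h : ‖koopman hu ψ - ψ‖ ≤ η * ‖ψ‖) :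
    ∑' x, μ x * ENNReal.ofReal (‖ψ x‖ ^ 2 - ‖ψ (u x)‖ ^ 2)
      ≤ ENNReal.ofReal (2 * η) * ‖ψ‖ₑ ^ 2 := by
  have hnorm : ‖koopman hu ψ‖ₑ = ‖ψ‖ₑ := by simp only [← ofReal_norm, LinearIsometry.norm_map]
  have hdiff : ‖ψ - koopman hu ψ‖ₑ ≤ ENNReal.ofReal η * ‖ψ‖ₑ := by
    rw [← ofReal_norm, ← ofReal_norm, ← ENNReal.ofReal_mul hη, norm_sub_rev]
    exact ENNReal.ofReal_le_ofReal h
  calc ∑' x, μ x * ENNReal.ofReal (‖ψ x‖ ^ 2 - ‖ψ (u x)‖ ^ 2)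
      = ∑' x, μ x * ENNReal.ofReal (‖ψ x‖ ^ 2 - ‖koopman hu ψ x‖ ^ 2) := by
        refine tsum_congr fun x => ?_
        by_cases hx : x ∈ μ.support
        · rw [koopman_apply hu ψ hx]
        · rw [(μ.apply_eq_zero_iff x).2 hx, zero_mul, zero_mul]
    _ ≤ ‖ψ - koopman hu ψ‖ₑ * ‖ψ‖ₑ + ‖ψ - koopman hu ψ‖ₑ * ‖koopman hu ψ‖ₑ :=
        WeightedL2.tsum_mul_ofReal_norm_sq_sub_norm_sq_le _ _
    _ ≤ ENNReal.ofReal η * ‖ψ‖ₑ * ‖ψ‖ₑ + ENNReal.ofReal η * ‖ψ‖ₑ * ‖ψ‖ₑ := by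
        rw [hnorm]
        gcongr
    _ = ENNReal.ofReal (2 * η) * ‖ψ‖ₑ ^ 2 := by
        rw [ENNReal.ofReal_mul zero_le_two, ENNReal.ofReal_ofNat]
        ring

variable [Fintype κ]

theorem tsum_mul_ofReal_norm_sq_sub_norm_sq_family_lt {u : κ → X → X}
    (hu : ∀ k, μ.map (u k) = μ) {ψ : WeightedL2 μ H} (hψ : ψ ≠ 0) {η ε : ℝ} (hη : 0 ≤ η)
    (hηε : Fintype.card κ * (2 * η) < ε) (h : ∀ k, ‖koopman (hu k) ψ - ψ‖ ≤ η * ‖ψ‖) :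
    ∑' p : κ × X, μ p.2 * ENNReal.ofReal (‖ψ p.2‖ ^ 2 - ‖ψ (u p.1 p.2)‖ ^ 2)
      < ∑' x, ENNReal.ofReal ε * μ x * ENNReal.ofReal (‖ψ x‖ ^ 2) := by
  have hε : 0 < ε := lt_of_le_of_lt (by positivity) hηε
  rw [ENNReal.tsum_prod', tsum_fintype]
  calc ∑ k, ∑' x, μ x * ENNReal.ofReal (‖ψ x‖ ^ 2 - ‖ψ (u k x)‖ ^ 2)
      ≤ ∑ _k : κ, ENNReal.ofReal (2 * η) * ‖ψ‖ₑ ^ 2 := Finset.sum_le_sum fun k _ =>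
        tsum_mul_ofReal_norm_sq_sub_norm_sq_comp_le (hu k) hη (h k)
    _ = ENNReal.ofReal (Fintype.card κ * (2 * η)) * ‖ψ‖ₑ ^ 2 := by
        rw [Finset.sum_const, Finset.card_univ, nsmul_eq_mul, ← mul_assoc,
          ENNReal.ofReal_mul (Nat.cast_nonneg _), ENNReal.ofReal_natCast]
    _ < ENNReal.ofReal ε * ‖ψ‖ₑ ^ 2 :=
        ENNReal.mul_lt_mul_left (by simpa using hψ) (by simp)
          ((ENNReal.ofReal_lt_ofReal_iff hε).2 hηε)
    _ = ∑' x, ENNReal.ofReal ε * μ x * ENNReal.ofReal (‖ψ x‖ ^ 2) := by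
        simp only [WeightedL2.enorm_sq, ← ENNReal.tsum_mul_left, mul_assoc,
          ENNReal.ofReal_pow (norm_nonneg _), ofReal_norm]

theorem exists_subset_supp_sum_toOuterMeasure_lt [Countable X] {u : κ → X → X}
    (hu : ∀ k, μ.map (u k) = μ) {ψ : WeightedL2 μ H} (hψ : ψ ≠ 0) {η ε : ℝ} (hη : 0 ≤ η)
    (hηε : Fintype.card κ * (2 * η) < ε) (h : ∀ k, ‖koopman (hu k) ψ - ψ‖ ≤ η * ‖ψ‖) :
    ∃ E ⊆ supp ψ, ∑ k, μ.toOuterMeasure {x ∈ E | u k x ∉ E}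
      < ENNReal.ofReal ε * μ.toOuterMeasure E := by
  obtain ⟨t, ht, hlt⟩ := exists_superlevel_tsum_indicator_lt (fun p : κ × X => u p.1 p.2) Prod.snd
    (fun p => μ p.2) (fun x => ENNReal.ofReal ε * μ x) (fun x => ‖ψ x‖ ^ 2)
    (tsum_mul_ofReal_norm_sq_sub_norm_sq_family_lt hu hψ hη hηε h)
  refine ⟨{x ∈ μ.support | t < ‖ψ x‖ ^ 2}, fun x hx => ⟨hx.1, fun h0 => ?_⟩, ?_⟩
  · exact ht.not_gt (by simpa [h0] using hx.2)
  rw [ENNReal.tsum_prod', tsum_fintype] at hlt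
  refine (Finset.sum_le_sum fun k _ => ?_).trans_lt (hlt.trans_eq ?_)
  · rw [PMF.toOuterMeasure_apply]
    refine ENNReal.tsum_le_tsum fun x => Set.indicator_apply_le' ?_ fun _ => zero_le
    rintro ⟨⟨hx, hxt⟩, hux⟩
    have hut : ¬ t < ‖ψ (u k x)‖ ^ 2 := fun h => hux ⟨apply_mem_support_of_map_eq (hu k) hx, h⟩
    rw [Set.indicator_of_mem (Set.mem_ofPred.2 ⟨hxt, hut⟩)]
  · rw [PMF.toOuterMeasure_apply, ← ENNReal.tsum_mul_left]
    refine tsum_congr fun x => ?_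
    by_cases hx : μ x = 0 <;> simp [Set.indicator_apply, hx]

theorem ONL.exists_folner [MetricSpace X] [Countable X] (h : ONL X) {L ε : ℝ} (hL : 0 ≤ L)
    (hε : 0 < ε) : ∃ S : ℝ, 0 < S ∧ ∀ (μ : PMF X) (u : κ → X → X), (∀ k, μ.map (u k) = μ) →
      (∀ k x, dist x (u k x) ≤ L) → ∃ E : Set X, Metric.ediam E ≤ ENNReal.ofReal S ∧
        ∑ k, μ.toOuterMeasure {x ∈ E | u k x ∉ E} < ENNReal.ofReal ε * μ.toOuterMeasure E := by
  obtain ⟨η, hη, hηε⟩ := exists_pos_mul_lt hε (Fintype.card κ * 2 : ℝ)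
  rw [mul_assoc] at hηε
  obtain ⟨S, hS, h⟩ := h.exists_koopman_almost_invariant (κ := κ) hL hη
  refine ⟨S, hS, fun μ u hu huL => ?_⟩
  obtain ⟨ψ, hψ, hdiam, hinv⟩ := h μ u hu huL
  obtain ⟨E, hE, hlt⟩ := exists_subset_supp_sum_toOuterMeasure_lt hu hψ hη.le hηε hinv
  exact ⟨E, (Metric.ediam_mono hE).trans hdiam, hlt⟩

theorem ONL.isAmenable {Γ : Type*} [Group Γ] {S : Finset Γ} {N : ℕ → Subgroup Γ}
    [∀ n, (N n).Normal] [MetricSpace (Σ n, Γ ⧸ N n)] (hX : IsBoxSpace S N)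
    (h : ONL (Σ n, Γ ⧸ N n)) : IsAmenable Γ := by
  have := hX.isSpaceOfGraphs.boundedGeometry.countable
  refine hX.isAmenable fun K ε hK hε => ?_
  have := hK.fintype
  obtain ⟨R, hR, hRK⟩ := hX.exists_forall_dist_mul_le hK
  obtain ⟨L, hL, h⟩ := h.exists_folner (κ := K) hR.le hε
  refine ⟨L, Eventually.of_forall fun n => ?_⟩
  have := hX.isSpaceOfGraphs.finite n
  have := Fintype.ofFinite (Γ ⧸ N n)
  let ι : Γ ⧸ N n → Σ n, Γ ⧸ N n := fun x => ⟨n, x⟩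
  let u (k : K) (x : Σ n, Γ ⧸ N n) : Σ n, Γ ⧸ N n := ⟨x.1, x.2 * ((k : Γ) : Γ ⧸ N x.1)⟩
  set ν : PMF (Γ ⧸ N n) := PMF.uniformOfFinset Finset.univ Finset.univ_nonempty with hν
  have hu (k : K) : (ν.map ι).map (u k) = ν.map ι := by
    have hcomp : u k ∘ ι = ι ∘ Equiv.mulRight ((k : Γ) : Γ ⧸ N n) := rfl
    rw [PMF.map_comp, hcomp, ← PMF.map_comp, hν, map_equiv_uniformOfFinset_univ]
  obtain ⟨E, hEd, hlt⟩ := h (ν.map ι) u hu fun k x => hRK k k.2 x.1 x.2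
  refine ⟨ι ⁻¹' E, ⟨Set.toFinite _, ?_, ?_⟩, fun x hx y hy => (edist_le_ofReal hL.le).1
    ((Metric.edist_le_ediam_of_mem (x := ι x) (y := ι y) hx hy).trans hEd)⟩
  · refine Set.nonempty_iff_ne_empty.2 fun hempty => hlt.not_ge ?_
    rw [PMF.toOuterMeasure_map_apply, hempty, measure_empty, mul_zero]
    exact zero_le
  rintro _ ⟨k, hk, rfl⟩
  have hklt := (Finset.single_le_sum (f := fun k => (ν.map ι).toOuterMeasure {x ∈ E | u k x ∉ E})
    (fun _ _ => zero_le) (Finset.mem_univ ⟨k, hk⟩)).trans_lt hlt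
  rw [PMF.toOuterMeasure_map_apply, PMF.toOuterMeasure_map_apply, hν,
    toOuterMeasure_uniformOfFinset_lt_iff _ hε.le, Finset.coe_univ, Set.inter_univ,
    Set.inter_univ] at hklt
  exact hklt.le

end FolnerFromLocalisation

end BoxSpaces

end

theorem mainTheorem7 {Γ : Type*} [Group Γ] (S : Finset Γ) (N : ℕ → Subgroup Γ)
    [∀ n, (N n).Normal] [MetricSpace (Σ n, Γ ⧸ N n)] (hX : BoxSpaces.IsBoxSpace S N) :
    List.TFAE [
      BoxSpaces.IsAmenable Γ,
      BoxSpaces.PropertyA (Σ n, Γ ⧸ N n) ∧ BoxSpaces.ULA (Σ n, Γ ⧸ N n) ∧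
        BoxSpaces.ULAmu (Σ n, Γ ⧸ N n) ∧ BoxSpaces.MSP (Σ n, Γ ⧸ N n) ∧
        BoxSpaces.ONL (Σ n, Γ ⧸ N n),
      BoxSpaces.PropertyA (Σ n, Γ ⧸ N n) ∨ BoxSpaces.ULA (Σ n, Γ ⧸ N n) ∨
        BoxSpaces.ULAmu (Σ n, Γ ⧸ N n) ∨ BoxSpaces.MSP (Σ n, Γ ⧸ N n) ∨
        BoxSpaces.ONL (Σ n, Γ ⧸ N n)] := by
  have hbg := hX.isSpaceOfGraphs.boundedGeometry
  tfae_have 1 → 2 := fun h =>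
    have hA := h.propertyA hX
    have hμ := hA.ulaMu hbg
    ⟨hA, hμ.ula, hμ, hμ.msp, hμ.msp.onl⟩
  tfae_have 2 → 3 := fun h => Or.inl h.1
  tfae_have 3 → 1 := by
    rintro (hA | hULA | hμ | hMSP | hONL)
    · exact (hA.ulaMu hbg).ula.isAmenable hX
    · exact hULA.isAmenable hX
    · exact hμ.ula.isAmenable hX
    · exact (hMSP.ulaMu hbg).ula.isAmenable hX
    · exact hONL.isAmenable hX
  tfae_finish
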